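/- Let $d\ge 1$, $1<p<\infty$, $T>0$, $u_0\in L^2=L^2(\mathbb R^d)$, and let $$Av=-\operatorname{div}(|\nabla v|^{p-2}\nabla v),\qquad D(A)=\{v\in L^2:\ \nabla v\in L^p,\ \operatorname{div}(|\nabla v|^{p-2}\nabla v)\in L^2\},$$ where $\nabla$ and $\operatorname{div}$ are taken in the sense of distributions on $\mathbb R^d$. Let $u$ be the weak solution on $[0,T]$ of the parabolic $p$-Laplace equation $\partial_t u=\operatorname{div}(|\nabla u|^{p-2}\nabla u)$ with initial value $u_0$, that is, a function $$u\in C([0,T];L^2)\cap\bigcap_{0<\delta<T}W^{1,2}([\delta,T];L^2),\qquad u(0)=u_0,$$ such that $u(t)\in D(A)$ for a.e. $t\in(0,T)$; $t^{1/2}\frac{du}{dt}\in L^2(0,T;L^2)$, $t^{1/2}Au\in L^2(0,T;L^2)$ and $|\nabla u|\in L^p(0,T;L^p)$; and $\frac{du}{dt}(t)=-Au(t)=\operatorname{div}(|\nabla u(t)|^{p-2}\nabla u(t))$ for a.e. $t\in(0,T)$, where $\frac{du}{dt}$ is the strong derivative in $L^2$. Write $|\cdot|_q$ for the norm of $L^q(\mathbb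 R^d)$ and identify $u$ with a measurable function $u(t,x)$ on $(0,T)\times\mathbb R^d$. 1. If $u_0\in L^\infty\cap L^2$, then $u\in L^\infty((0,T)\times\mathbb R^d)$ and $|u(t)|_\infty\le|u_0|_\infty$ for a.e. $t\in(0,T)$. 2. If $u_0\in L^1\cap L^2$, then $u\in L^\infty(0,T;L^1)$. If in addition $u_0\ge0$ a.e. on $\mathbb R^d$, then $u\ge0$ a.e. on $(0,T)\times\mathbb R^d$. 3. If $u_0\in L^1\cap L^2$ and $p\ge d$, then, for all $t\in[0,T]$, $u(t)\in L^1$ and $$\int_{\mathbb R^d}u(t,x)\,dx=\int_{\mathbb R^d}u_0(x)\,dx.$$ -/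

import Mathlib

open MeasureTheory Set

namespace PLaplace

/-- Euclidean space `ℝ^d`. -/
abbrev Space (d : ℕ) : Type := EuclideanSpace ℝ (Fin d)

/-- The Hilbert space `H = L²(ℝ^d)`. -/
abbrev L2 (d : ℕ) : Type := Lp ℝ 2 (volume : Measure (Space d))

/-- Lebesgue measure on the cylinder `(0,T) × ℝ^d`. -/
noncomputable abbrev cylMeasure (d : ℕ) (T : ℝ) : Measure (ℝ × Space d) :=
  (volume : Measure (ℝ × Space d)).restrict (Ioo 0 T ×ˢ univ)

/-- `φ ∈ C_c^∞(V)`. -/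
def IsTestFunction {V : Type*} [NormedAddCommGroup V] [NormedSpace ℝ V] (φ : V → ℝ) : Prop :=
  ContDiff ℝ (⊤ : ℕ∞) φ ∧ HasCompactSupport φ

/-- `G = ∇v` in the sense of distributions on `ℝ^d` (tested in every direction `y`). -/
def HasWeakGradient {d : ℕ} (v : Space d → ℝ) (G : Space d → Space d) : Prop :=
  LocallyIntegrable v ∧ LocallyIntegrable G ∧
    ∀ φ : Space d → ℝ, IsTestFunction φ → ∀ y : Space d,
      ∫ x, v x * fderiv ℝ φ x y = -∫ x, φ x * inner ℝ (G x) y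

/-- `f = div F` in the sense of distributions on `ℝ^d`;
here `fderiv ℝ φ x (F x) = ∇φ(x) · F(x)`. -/
def HasWeakDivergence {d : ℕ} (F : Space d → Space d) (f : Space d → ℝ) : Prop :=
  LocallyIntegrable F ∧ LocallyIntegrable f ∧
    ∀ φ : Space d → ℝ, IsTestFunction φ →
      ∫ x, fderiv ℝ φ x (F x) = -∫ x, φ x * f x

/-- The graph of the operator `A v = -div(|∇v|^{p-2} ∇v)` in `L²(ℝ^d)`: `IsNegPLaplacian p v f`
says that `v` belongs to
`D(A) = {v ∈ L² : ∇v ∈ L^p, div(|∇v|^{p-2} ∇v) ∈ L²}` and that `A v = f`.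
Where `∇v = 0` the field `|∇v|^{p-2} ∇v` is `0`, also for `p < 2`. -/
def IsNegPLaplacian {d : ℕ} (p : ℝ) (v f : L2 d) : Prop :=
  ∃ G : Space d → Space d,
    MemLp G (ENNReal.ofReal p) volume ∧ HasWeakGradient v G ∧
      HasWeakDivergence (fun x => ‖G x‖ ^ (p - 2) • G x) (fun x => -f x)

/-- `u ∈ W^{1,2}([a,b];H)`: `u` and its `H`-valued distributional derivative on `(a,b)`
belong to `L²(a,b;H)`. -/
def MemW12 {H : Type*} [NormedAddCommGroup H] [NormedSpace ℝ H] (a b : ℝ) (u : ℝ → H) : Prop :=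
  MemLp u 2 (volume.restrict (Ioo a b)) ∧
    ∃ g : ℝ → H, MemLp g 2 (volume.restrict (Ioo a b)) ∧
      ∀ φ : ℝ → ℝ, IsTestFunction φ → tsupport φ ⊆ Ioo a b →
        ∫ t in Ioo a b, deriv φ t • u t = -∫ t in Ioo a b, φ t • g t

/-- `u : [0,T] → L²(ℝ^d)` is the weak solution on `[0,T]` of
`∂u/∂t = div(|∇u|^{p-2} ∇u)`, `u(0) = u₀` (values of `u` outside `[0,T]` are irrelevant). -/
structure IsWeakSolution {d : ℕ} (p T : ℝ) (u₀ : L2 d) (u : ℝ → L2 d) : Prop where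
  /-- `u ∈ C([0,T];L²)` -/
  continuousOn : ContinuousOn u (Icc 0 T)
  /-- `u(0) = u₀` -/
  initial : u 0 = u₀
  /-- `u ∈ W^{1,2}([δ,T];L²)` for all `0 < δ < T` -/
  memW12 : ∀ δ : ℝ, 0 < δ → δ < T → MemW12 δ T u
  /-- `|∇u| ∈ L^p(0,T;L^p) = L^p((0,T) × ℝ^d)` -/
  gradient : ∃ G : ℝ × Space d → Space d, MemLp G (ENNReal.ofReal p) (cylMeasure d T) ∧
    ∀ᵐ t ∂(volume.restrict (Ioo 0 T)), HasWeakGradient (u t) (fun x => G (t, x))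
  /-- `t^{1/2} du/dt ∈ L²(0,T;L²)` -/
  sqrt_deriv : MemLp (fun t => Real.sqrt t • deriv u t) 2 (volume.restrict (Ioo 0 T))
  /-- `u(t) ∈ D(A)` for a.e. `t`, `t^{1/2} Au ∈ L²(0,T;L²)`, and the strong derivative of `u`
  satisfies `du/dt(t) = -A u(t) = div(|∇u(t)|^{p-2} ∇u(t))` for a.e. `t ∈ (0,T)` -/
  equation : ∃ a : ℝ → L2 d,
    MemLp (fun t => Real.sqrt t • a t) 2 (volume.restrict (Ioo 0 T)) ∧
      ∀ᵐ t ∂(volume.restrict (Ioo 0 T)), IsNegPLaplacian p (u t) (a t) ∧ HasDerivAt u (-a t) t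

/-- `U` is the function `(t,x) ↦ u(t,x)` on `(0,T) × ℝ^d` (unique up to null sets) with which the
`L²`-valued function `u` is identified. -/
def IsSpaceTimeVersion {d : ℕ} (T : ℝ) (u : ℝ → L2 d) (U : ℝ × Space d → ℝ) : Prop :=
  AEStronglyMeasurable U (cylMeasure d T) ∧
    ∀ᵐ t ∂(volume.restrict (Ioo 0 T)), (fun x => U (t, x)) =ᵐ[volume] u t

/-- `u ∈ L^∞(0,T;L¹)`: for a.e. `t` the class `u(t)` lies in `L¹(ℝ^d)`, and as an `L¹`-valued
function `u` is Bochner measurable and essentially bounded. -/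
def MemLinftyL1 {d : ℕ} (T : ℝ) (u : ℝ → L2 d) : Prop :=
  ∃ v : ℝ → Lp ℝ 1 (volume : Measure (Space d)),
    MemLp v ⊤ (volume.restrict (Ioo 0 T)) ∧
      ∀ᵐ t ∂(volume.restrict (Ioo 0 T)), (v t : Space d → ℝ) =ᵐ[volume] u t

end PLaplace

/-! The operator `A` is accretive against every smooth bounded nondecreasing `β` that vanishes near
`0`: formally `∫ β(v) A v = ∫ β'(v) |∇v|^p ≥ 0` (`IsNegPLaplacian.integral_truncation_mul_nonneg`).
Such a `β(v)` is bounded and lives on a set of finite measure, so it lies in every `L^q` and pairs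
with the flux `|∇v|^{p-2}∇v` in `L^{p/(p-1)}`. To get an admissible test function, `v` is mollified
inside `β` and the product is multiplied by a cutoff.

If `j' = β` and `j(0) = 0`, then `∫ j(u(t))` has derivative `-⟨β(u), A u⟩ ≤ 0`, so it never exceeds
its initial value (`IsWeakSolution.energy_le`). Take for `β` a smooth step rising from `0` to `1` on
`[m, 2m]`. With `m` just above an upper bound `M ≥ 0` of `u₀`, the energy starts at `0` and stays
there, so `u ≤ M`. As `m → 0`, `j` tends to the positive part and `∫ u⁺ ≤ ∫ u₀⁺`. The reflected
steps give the same for `-u`. This yields the sup bound, the `L¹` bound and positivity.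

For the mass, test the equation with a cutoff `χ` at scale `n + 1`: `∫ χ u` changes by at most `∫∫
|∇χ| |∇u|^{p-1}`. When `p ≥ d`, `∇χ` stays bounded in `L^p`, while the flux is only seen on `|x| ≥ n
+ 1`, where its `L^{p/(p-1)}` norm tends to `0` (`tendsto_cutoffFlux`). -/

namespace PLaplace

open Filter Topology

/-! ### Absolute continuity in time. -/

section Time

theorem absolutelyContinuousOnInterval_of_dist_le {X Y : Type*} [PseudoMetricSpace X]
    [PseudoMetricSpace Y] {f : ℝ → X} {K : ℝ → Y} {a b : ℝ}
    (hK : AbsolutelyContinuousOnInterval K a b)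
    (h : ∀ x ∈ uIcc a b, ∀ y ∈ uIcc a b, dist (f x) (f y) ≤ dist (K x) (K y)) :
    AbsolutelyContinuousOnInterval f a b := by
  rw [absolutelyContinuousOnInterval_iff] at hK ⊢
  intro ε hε
  obtain ⟨δ, hδ, H⟩ := hK ε hε
  refine ⟨δ, hδ, fun E hE hE' => lt_of_le_of_lt (Finset.sum_le_sum fun i hi => ?_) (H E hE hE')⟩
  exact h _ (hE.1 i hi).1 _ (hE.1 i hi).2

theorem absolutelyContinuousOnInterval_of_lipschitz_comp {X Y : Type*} [PseudoMetricSpace X]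
    [PseudoMetricSpace Y] {f : ℝ → X} {K : ℝ → Y} {a b C : ℝ}
    (hK : AbsolutelyContinuousOnInterval K a b)
    (h : ∀ x ∈ uIcc a b, ∀ y ∈ uIcc a b, dist (f x) (f y) ≤ C * dist (K x) (K y)) :
    AbsolutelyContinuousOnInterval f a b := by
  rw [absolutelyContinuousOnInterval_iff] at hK ⊢
  intro ε hε
  obtain ⟨δ, hδ, H⟩ := hK (ε / (|C| + 1)) (by positivity)
  refine ⟨δ, hδ, fun E hE hE' => ?_⟩
  have h1 := H E hE hE'
  calc _ ≤ ∑ i ∈ Finset.range E.1, (|C| + 1) * dist (K (E.2 i).1) (K (E.2 i).2) := by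
        refine Finset.sum_le_sum fun i hi => (h _ (hE.1 i hi).1 _ (hE.1 i hi).2).trans ?_
        gcongr
        linarith [le_abs_self C]
    _ < ε := by
        rw [← Finset.mul_sum]
        rw [lt_div_iff₀ (by positivity)] at h1
        linarith

/-- An absolutely continuous function grows at most by the integral of a bound for its derivative.
-/
theorem sub_le_integral_of_ae_hasDerivAt_le {f h : ℝ → ℝ} {a b : ℝ} (hab : a ≤ b)
    (hf : AbsolutelyContinuousOnInterval f a b) (hh : IntervalIntegrable h volume a b)
    (hd : ∀ᵐ t ∂(volume.restrict (Ioo a b)), ∃ d ≤ h t, HasDerivAt f d t) :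
    f b - f a ≤ ∫ t in a..b, h t := by
  rw [← hf.integral_deriv_eq_sub]
  refine intervalIntegral.integral_mono_ae_restrict hab hf.intervalIntegrable_deriv hh ?_
  rw [← restrict_Ioo_eq_restrict_Icc]
  filter_upwards [hd] with t ht
  obtain ⟨d, hd, hd'⟩ := ht
  rw [hd'.deriv]
  exact hd

variable {H : Type*} [NormedAddCommGroup H] [NormedSpace ℝ H] [CompleteSpace H]

/-- A smooth approximation of the indicator function of an interval. -/
noncomputable def smoothIndicator (ρ : ContDiffBump (0 : ℝ)) (s t x : ℝ) : ℝ :=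
  ∫ y in (x - t)..(x - s), ρ.normed volume y

theorem hasDerivAt_smoothIndicator (ρ : ContDiffBump (0 : ℝ)) (s t x : ℝ) :
    HasDerivAt (smoothIndicator ρ s t)
      (ρ.normed volume (x - s) - ρ.normed volume (x - t)) x := by
  have hc : Continuous (ρ.normed volume) := ρ.continuous_normed
  have h : smoothIndicator ρ s t = fun x => (∫ y in (0 : ℝ)..(x - s), ρ.normed volume y) -
      ∫ y in (0 : ℝ)..(x - t), ρ.normed volume y := by
    ext x
    rw [smoothIndicator, intervalIntegral.integral_interval_sub_left]
    · exact hc.intervalIntegrable _ _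
    · exact hc.intervalIntegrable _ _
  rw [h]
  have key : ∀ c, HasDerivAt (fun x => ∫ y in (0 : ℝ)..(x - c), ρ.normed volume y)
      (ρ.normed volume (x - c)) x := fun c => by
    have := (intervalIntegral.integral_hasDerivAt_right (hc.intervalIntegrable 0 (x - c))
      (hc.stronglyMeasurableAtFilter _ _) hc.continuousAt).comp x ((hasDerivAt_id x).sub_const c)
    simpa [Function.comp_def] using this
  exact (key s).sub (key t)

theorem contDiff_smoothIndicator (ρ : ContDiffBump (0 : ℝ)) (s t : ℝ) :
    ContDiff ℝ (⊤ : ℕ∞) (smoothIndicator ρ s t) := by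
  rw [contDiff_infty_iff_deriv]
  refine ⟨fun x => (hasDerivAt_smoothIndicator ρ s t x).differentiableAt, ?_⟩
  rw [show deriv (smoothIndicator ρ s t) = fun x => ρ.normed volume (x - s) -
    ρ.normed volume (x - t) from funext fun x => (hasDerivAt_smoothIndicator ρ s t x).deriv]
  have h : ContDiff ℝ (⊤ : ℕ∞) (ρ.normed volume) := ρ.contDiff_normed
  exact (h.comp (contDiff_id.sub contDiff_const)).sub (h.comp (contDiff_id.sub contDiff_const))

theorem normed_eq_zero_of_le {ρ : ContDiffBump (0 : ℝ)} {y : ℝ} (hy : ρ.rOut ≤ |y|) :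
    ρ.normed volume y = 0 := by
  have : y ∉ Function.support (ρ.normed volume) := by
    rw [ρ.support_normed_eq]
    simpa using hy
  simpa using this

theorem smoothIndicator_eq_zero {ρ : ContDiffBump (0 : ℝ)} {s t x : ℝ} (hst : s ≤ t)
    (hx : x ∉ Icc (s - ρ.rOut) (t + ρ.rOut)) : smoothIndicator ρ s t x = 0 := by
  rw [smoothIndicator]
  refine intervalIntegral.integral_zero_ae (Eventually.of_forall fun y hy => ?_)
  rw [uIoc_of_le (by linarith)] at hy
  apply normed_eq_zero_of_le
  rw [mem_Icc, not_and_or, not_le, not_le] at hx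
  have := hy.1
  have := hy.2
  rcases hx with hx | hx
  · rw [le_abs]; right; linarith
  · rw [le_abs]; left; linarith

theorem smoothIndicator_nonneg (ρ : ContDiffBump (0 : ℝ)) {s t : ℝ} (hst : s ≤ t) (x : ℝ) :
    0 ≤ smoothIndicator ρ s t x :=
  intervalIntegral.integral_nonneg (by linarith) fun y _ => ρ.nonneg_normed y

theorem smoothIndicator_le_one (ρ : ContDiffBump (0 : ℝ)) {s t : ℝ} (hst : s ≤ t) (x : ℝ) :
    smoothIndicator ρ s t x ≤ 1 := by
  rw [smoothIndicator, intervalIntegral.integral_of_le (by linarith), ← ρ.integral_normed (μ := volume)]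
  exact setIntegral_le_integral ρ.integrable_normed (Eventually.of_forall ρ.nonneg_normed)

/-- The bumps of radii `1/(n+1)` and `2/(n+1)` around the origin. -/
noncomputable def stdBump (V : Type*) [NormedAddCommGroup V] (n : ℕ) : ContDiffBump (0 : V) where
  rIn := 1 / (n + 1)
  rOut := 2 / (n + 1)
  rIn_pos := by positivity
  rIn_lt_rOut := by gcongr; norm_num

theorem tendsto_stdBump_rOut (V : Type*) [NormedAddCommGroup V] :
    Tendsto (fun n => (stdBump V n).rOut) atTop (𝓝 0) := by
  have := (tendsto_one_div_add_atTop_nhds_zero_nat (𝕜 := ℝ)).const_mul 2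
  simp only [mul_one_div, mul_zero] at this
  exact this

/-- The weak derivative is tested with a smoothed indicator of `[s, t]`. Its derivative is a
difference of two bumps concentrating at `s` and `t`, so one side tends to `u s - u t`; the other is
controlled by the norm of the weak derivative over a slightly larger interval. Only this bound is
needed: the weak derivative is never identified with the strong one. -/
theorem MemW12.norm_sub_le {a b : ℝ} (hab : a ≤ b) {u : ℝ → H} (hu : MemW12 a b u)
    (hc : ContinuousOn u (Icc a b)) :
    ∃ k : ℝ → ℝ, Integrable k ∧ (∀ x, 0 ≤ k x) ∧
      ∀ s t, a < s → s ≤ t → t < b → ‖u t - u s‖ ≤ ∫ x in s..t, k x := by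
  obtain ⟨-, g, hg, hw⟩ := hu
  have hgi : IntegrableOn g (Ioo a b) := hg.integrable (by norm_num)
  set k : ℝ → ℝ := (Ioo a b).indicator fun x => ‖g x‖ with hk
  have hki : Integrable k := IntegrableOn.integrable_indicator hgi.norm measurableSet_Ioo
  have hk0 : ∀ x, 0 ≤ k x := fun x => indicator_nonneg (fun _ _ => norm_nonneg _) x
  refine ⟨k, hki, hk0, fun s t has hst htb => ?_⟩
  -- Clamping time to `[a, b]` gives a function continuous on all of `ℝ`, as convolution requires.
  set v : ℝ → H := fun x => u (projIcc a b hab x) with hv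
  have hvc : Continuous v := hc.comp_continuous (by fun_prop) fun x => (projIcc a b hab x).2
  have hvu : ∀ x ∈ Icc a b, v x = u x := fun x hx => by simp [hv, projIcc_of_mem hab hx]
  set ρ := fun n => stdBump ℝ n with hρ
  have hr := tendsto_stdBump_rOut ℝ
  have hconv : ∀ x₀, Tendsto (fun n => ∫ x, (ρ n).normed volume (x - x₀) • v x) atTop
      (𝓝 (v x₀)) := fun x₀ => by
    have := ContDiffBump.convolution_tendsto_right_of_continuous (μ := volume) hr hvc x₀
    refine this.congr fun n => ?_
    rw [convolution_lsmul_swap]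
    congr 1; ext x
    rw [← ContDiffBump.normed_neg, neg_sub]
  have hL : Tendsto (fun n => ‖(∫ x, (ρ n).normed volume (x - t) • v x) -
      ∫ x, (ρ n).normed volume (x - s) • v x‖) atTop (𝓝 ‖v t - v s‖) :=
    ((hconv t).sub (hconv s)).norm
  have hprim : Continuous fun x => ∫ y in (0 : ℝ)..x, k y :=
    intervalIntegral.continuous_primitive (fun _ _ => hki.intervalIntegrable) 0
  have hR : Tendsto (fun n => (∫ y in (0 : ℝ)..(t + (ρ n).rOut), k y) -
      ∫ y in (0 : ℝ)..(s - (ρ n).rOut), k y) atTop (𝓝 (∫ y in s..t, k y)) := by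
    have h1 : Tendsto (fun n => t + (ρ n).rOut) atTop (𝓝 t) := by simpa using hr.const_add t
    have h2 : Tendsto (fun n => s - (ρ n).rOut) atTop (𝓝 s) := by simpa using hr.const_sub s
    rw [← intervalIntegral.integral_interval_sub_left (a := 0) hki.intervalIntegrable
      hki.intervalIntegrable]
    exact ((hprim.tendsto t).comp h1).sub ((hprim.tendsto s).comp h2)
  rw [← hvu s ⟨has.le, by linarith⟩, ← hvu t ⟨by linarith, htb.le⟩]
  refine le_of_tendsto_of_tendsto hL hR ?_
  filter_upwards [hr.eventually (gt_mem_nhds (sub_pos.2 has)),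
    hr.eventually (gt_mem_nhds (sub_pos.2 htb))] with n hn1 hn2
  have hn1 : (ρ n).rOut < s - a := hn1
  have hn2 : (ρ n).rOut < b - t := hn2
  have hr0 := (ρ n).rOut_pos
  set φ := smoothIndicator (ρ n) s t with hφ
  have hsub : tsupport φ ⊆ Icc (s - (ρ n).rOut) (t + (ρ n).rOut) :=
    closure_minimal (fun x hx => by
      by_contra h
      exact hx (smoothIndicator_eq_zero hst h)) isClosed_Icc
  have hsubset : Icc (s - (ρ n).rOut) (t + (ρ n).rOut) ⊆ Ioo a b := fun x hx =>
    ⟨by linarith [hx.1], by linarith [hx.2]⟩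
  have hφt : IsTestFunction φ := ⟨contDiff_smoothIndicator _ _ _,
    HasCompactSupport.of_support_subset_isCompact isCompact_Icc (subset_closure.trans hsub)⟩
  have hw' := hw φ hφt (hsub.trans hsubset)
  have hφd : ∀ x, deriv φ x = (ρ n).normed volume (x - s) - (ρ n).normed volume (x - t) :=
    fun x => (hasDerivAt_smoothIndicator _ _ _ x).deriv
  have hint : ∀ c, Integrable fun x => (ρ n).normed volume (x - c) • v x := fun c => by
    have hcs : HasCompactSupport fun x => (ρ n).normed volume (x - c) :=
      (ρ n).hasCompactSupport_normed.comp_homeomorph (Homeomorph.subRight c)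
    have hcc : Continuous fun x => (ρ n).normed volume (x - c) :=
      (ρ n).continuous_normed.comp (by fun_prop)
    exact (hcc.smul hvc).integrable_of_hasCompactSupport hcs.smul_right
  have hleft : ∫ x in Ioo a b, deriv φ x • u x = (∫ x, (ρ n).normed volume (x - s) • v x) -
      ∫ x, (ρ n).normed volume (x - t) • v x := by
    rw [← integral_sub (hint s) (hint t)]
    refine (setIntegral_congr_fun measurableSet_Ioo fun x hx => ?_).trans
      (setIntegral_eq_integral_of_forall_compl_eq_zero (s := Ioo a b) fun x hx => ?_)
    · simp only [hφd, sub_smul, hvu x ⟨hx.1.le, hx.2.le⟩]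
    · rw [← sub_smul, ← hφd]
      have hxt : x ∉ tsupport φ := fun h => hx (hsubset (hsub h))
      have h0 : deriv φ x = 0 := by
        have := fun h => hxt (support_deriv_subset (f := φ) (𝕜 := ℝ) h)
        simpa using this
      rw [h0, zero_smul]
  rw [norm_sub_rev, ← hleft, hw', norm_neg]
  calc ‖∫ x in Ioo a b, φ x • g x‖ ≤ ∫ x in Ioo a b, ‖φ x • g x‖ := norm_integral_le_integral_norm _
    _ = ∫ x, (Ioo a b).indicator (fun x => ‖φ x • g x‖) x :=
        (integral_indicator measurableSet_Ioo).symm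
    _ ≤ ∫ x, (Ioc (s - (ρ n).rOut) (t + (ρ n).rOut)).indicator k x := by
        refine integral_mono_of_nonneg
          (Eventually.of_forall fun x => indicator_nonneg (fun _ _ => norm_nonneg _) x)
          (hki.indicator measurableSet_Ioc) ?_
        -- The support bound is for the closed interval and the majorant for the half-open one; they
        -- differ at this point only.
        have : ∀ᵐ x : ℝ, x ≠ s - (ρ n).rOut := by simp [ae_iff]
        filter_upwards [this] with x hx
        by_cases hxI : x ∈ Ioc (s - (ρ n).rOut) (t + (ρ n).rOut)
        · have hx2 : x ∈ Ioo a b := hsubset (Ioc_subset_Icc_self hxI)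
          simp only [hk, indicator_of_mem hxI, indicator_of_mem hx2, norm_smul]
          refine mul_le_of_le_one_left (norm_nonneg _) ?_
          rw [Real.norm_of_nonneg (smoothIndicator_nonneg _ hst _)]
          exact smoothIndicator_le_one _ hst _
        · have hx3 : x ∉ Icc (s - (ρ n).rOut) (t + (ρ n).rOut) := fun h =>
            hxI ⟨lt_of_le_of_ne h.1 (Ne.symm hx), h.2⟩
          have h0 : φ x = 0 := smoothIndicator_eq_zero hst hx3
          simp only [indicator_of_notMem hxI]
          by_cases hx2 : x ∈ Ioo a b
          · simp [indicator_of_mem hx2, h0]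
          · simp [indicator_of_notMem hx2]
    _ = _ := by
        rw [integral_indicator measurableSet_Ioc, ← intervalIntegral.integral_of_le (by linarith),
          intervalIntegral.integral_interval_sub_left hki.intervalIntegrable
            hki.intervalIntegrable]

/-- A continuous function in `W^{1,2}` is locally absolutely continuous. -/
theorem MemW12.absolutelyContinuousOnInterval {a b s t : ℝ} {u : ℝ → H} (hu : MemW12 a b u)
    (hc : ContinuousOn u (Icc a b)) (has : a < s) (hst : s ≤ t) (htb : t < b) :
    AbsolutelyContinuousOnInterval u s t := by
  obtain ⟨k, hk, hk0, hle⟩ := hu.norm_sub_le (by linarith) hc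
  have hK := (hk.intervalIntegrable (a := s) (b := t)
    ).absolutelyContinuousOnInterval_intervalIntegral (c := s) left_mem_uIcc
  refine absolutelyContinuousOnInterval_of_dist_le hK ?_
  have key : ∀ x ∈ uIcc s t, ∀ y ∈ uIcc s t, x ≤ y → dist (u x) (u y) ≤
      dist (∫ v in s..x, k v) (∫ v in s..y, k v) := by
    intro x hx y hy hxy
    rw [uIcc_of_le hst] at hx hy
    rw [dist_comm, dist_eq_norm, dist_comm, dist_eq_norm,
      intervalIntegral.integral_interval_sub_left hk.intervalIntegrable hk.intervalIntegrable]
    refine (hle x y (by linarith [hx.1]) hxy (by linarith [hy.2])).trans (le_abs_self _)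
  intro x hx y hy
  rcases le_total x y with h | h
  · exact key x hx y hy h
  · rw [dist_comm, dist_comm (∫ v in s..x, k v)]
    exact key y hy x hx h

end Time

end PLaplace

namespace PLaplace

open Filter Topology ContinuousLinearMap

/-! ### Mollification in space. -/

section Mollification

variable {d : ℕ} {E : Type*} [NormedAddCommGroup E] [NormedSpace ℝ E]

/-- Mollification at scale `2/(n+1)`. -/
noncomputable def mollify (n : ℕ) (g : Space d → E) : Space d → E :=
  convolution ((stdBump (Space d) n).normed volume) g (lsmul ℝ ℝ) volume

theorem mollify_apply (n : ℕ) (g : Space d → E) (x : Space d) :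
    mollify n g x = ∫ y, (stdBump (Space d) n).normed volume (x - y) • g y :=
  convolution_lsmul_swap

theorem mollify_congr {g g' : Space d → E} (h : g =ᵐ[volume] g') (n : ℕ) :
    mollify n g = mollify n g' :=
  convolution_congr _ (ae_eq_refl _) h

theorem convolutionExists_stdBump {g : Space d → E} (hg : LocallyIntegrable g) (n : ℕ) :
    ConvolutionExists ((stdBump (Space d) n).normed volume) g (lsmul ℝ ℝ) volume :=
  (stdBump (Space d) n).hasCompactSupport_normed.convolutionExists_left _
    (stdBump (Space d) n).continuous_normed hg

theorem mollify_add {g h : Space d → E} (hg : LocallyIntegrable g) (hh : LocallyIntegrable h)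
    (n : ℕ) : mollify n (g + h) = mollify n g + mollify n h := by
  ext x
  exact (convolutionExists_stdBump hg n x).distrib_add (convolutionExists_stdBump hh n x)

theorem contDiff_mollify {g : Space d → E} (hg : LocallyIntegrable g) (n : ℕ) :
    ContDiff ℝ (⊤ : ℕ∞) (mollify n g) :=
  (stdBump (Space d) n).hasCompactSupport_normed.contDiff_convolution_left _
    (stdBump (Space d) n).contDiff_normed hg

theorem ae_tendsto_mollify {g : Space d → E} (hg : LocallyIntegrable g) [CompleteSpace E] :
    ∀ᵐ x, Tendsto (fun n => mollify n g x) atTop (𝓝 (g x)) :=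
  ContDiffBump.ae_convolution_tendsto_right_of_locallyIntegrable (K := 2)
    (tendsto_stdBump_rOut (Space d)) (Eventually.of_forall fun n => by
      simp only [stdBump]
      rw [mul_one_div]) hg

/-- The kernel is a probability density, so monotonicity of `L^q` norms in the exponent bounds the
`p`-th power of an average by the average of `p`-th powers; Tonelli and translation invariance
finish. -/
theorem eLpNorm_mollify_le {p : ℝ} (hp : 1 ≤ p) {g : Space d → E}
    (hg : AEStronglyMeasurable g) (n : ℕ) :
    eLpNorm (mollify n g) (ENNReal.ofReal p) volume ≤ eLpNorm g (ENNReal.ofReal p) volume := by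
  wlog hgm : StronglyMeasurable g generalizing g
  · rw [mollify_congr hg.ae_eq_mk, eLpNorm_congr_ae hg.ae_eq_mk]
    exact this hg.stronglyMeasurable_mk.aestronglyMeasurable hg.stronglyMeasurable_mk
  have hp0 : 0 < p := by linarith
  have hpo : ENNReal.ofReal p ≠ 0 := by simpa using hp0
  set ρ := (stdBump (Space d) n).normed (volume : Measure (Space d)) with hρ
  have hρc : Continuous ρ := (stdBump (Space d) n).continuous_normed
  set ν := (volume : Measure (Space d)).withDensity fun t => ENNReal.ofReal (ρ t) with hν
  have hνp : IsProbabilityMeasure ν := by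
    refine ⟨?_⟩
    rw [hν, withDensity_apply _ MeasurableSet.univ, Measure.restrict_univ, ← ofReal_integral_eq_lintegral_ofReal (stdBump (Space d) n).integrable_normed
      (Eventually.of_forall (stdBump (Space d) n).nonneg_normed),
      (stdBump (Space d) n).integral_normed, ENNReal.ofReal_one]
  have hmeas : StronglyMeasurable fun z : Space d × Space d => g (z.1 - z.2) :=
    hgm.comp_measurable (measurable_fst.sub measurable_snd)
  have h1 : ∀ x, ‖mollify n g x‖ₑ ^ p ≤ ∫⁻ t, ‖g (x - t)‖ₑ ^ p ∂ν := by
    intro x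
    have hx : StronglyMeasurable fun t => g (x - t) := hgm.comp_measurable (by fun_prop)
    have e : mollify n g x = ∫ t, g (x - t) ∂ν := by
      rw [hν, integral_withDensity_eq_integral_toReal_smul (by fun_prop)
        (Eventually.of_forall fun _ => ENNReal.ofReal_lt_top)]
      rw [mollify, convolution_def]
      refine integral_congr_ae (Eventually.of_forall fun t => ?_)
      simp only [lsmul_apply]
      rw [ENNReal.toReal_ofReal ((stdBump (Space d) n).nonneg_normed t)]
    rw [lintegral_rpow_enorm_eq_rpow_eLpNorm' hp0]
    refine ENNReal.rpow_le_rpow ?_ hp0.le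
    calc ‖mollify n g x‖ₑ ≤ ∫⁻ t, ‖g (x - t)‖ₑ ∂ν := by
          rw [e]; exact enorm_integral_le_lintegral_enorm _
      _ = eLpNorm' (fun t => g (x - t)) 1 ν := by simp [eLpNorm']
      _ ≤ eLpNorm' (fun t => g (x - t)) p ν :=
          eLpNorm'_le_eLpNorm'_of_exponent_le one_pos hp ν hx.aestronglyMeasurable
  have h2 : ∫⁻ x, ‖mollify n g x‖ₑ ^ p ≤ ∫⁻ x, ‖g x‖ₑ ^ p := by
    calc _ ≤ ∫⁻ x, ∫⁻ t, ‖g (x - t)‖ₑ ^ p ∂ν := lintegral_mono h1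
      _ = ∫⁻ t, ∫⁻ x, ‖g (x - t)‖ₑ ^ p ∂volume ∂ν :=
          lintegral_lintegral_swap (hmeas.enorm.pow_const p).aemeasurable
      _ = ∫⁻ t, ∫⁻ x, ‖g x‖ₑ ^ p ∂volume ∂ν := by
          congr 1; ext t
          exact lintegral_sub_right_eq_self (fun x => ‖g x‖ₑ ^ p) t
      _ = _ := by simp
  rw [eLpNorm_eq_lintegral_rpow_enorm_toReal hpo ENNReal.ofReal_ne_top,
    eLpNorm_eq_lintegral_rpow_enorm_toReal hpo ENNReal.ofReal_ne_top, ENNReal.toReal_ofReal hp0.le]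
  exact ENNReal.rpow_le_rpow h2 (by positivity)

theorem tendsto_eLpNorm_mollify_sub_of_hasCompactSupport [CompleteSpace E] {p : ENNReal}
    {g : Space d → E} (hgc : Continuous g) (hgs : HasCompactSupport g) :
    Tendsto (fun n => eLpNorm (mollify n g - g) p volume) atTop (𝓝 0) := by
  obtain ⟨R, hR⟩ := hgs.isCompact.isBounded.subset_closedBall 0
  have huc : UniformContinuous g := hgs.uniformContinuous_of_continuous hgc
  -- The bump radius `2/(n+1)` never exceeds `2`, so this ball contains all the supports at once,
  -- and uniform smallness becomes smallness in `L^p`.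
  set K := Metric.closedBall (0 : Space d) (R + 2)
  have hK : volume K ≠ ⊤ := (isCompact_closedBall _ _).measure_lt_top.ne
  have hCtop : (volume.restrict K univ) ^ p.toReal⁻¹ ≠ ⊤ := by
    rw [Measure.restrict_apply_univ]
    exact ENNReal.rpow_ne_top_of_nonneg (by positivity) hK
  set C := (volume.restrict K univ) ^ p.toReal⁻¹
  have key : ∀ ε > 0, ∀ᶠ n in atTop, eLpNorm (mollify n g - g) p volume ≤ C * ENNReal.ofReal ε := by
    intro ε hε
    obtain ⟨δ, hδ, H⟩ := Metric.uniformContinuous_iff.1 huc ε hε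
    filter_upwards [(tendsto_stdBump_rOut (Space d)).eventually (gt_mem_nhds hδ)] with n hn
    have hn' : (stdBump (Space d) n).rOut ≤ 2 := by
      simp only [stdBump]
      exact div_le_self (by norm_num) (by simp)
    have hd : ∀ x, ‖(mollify n g - g) x‖ ≤ ε := fun x => by
      rw [Pi.sub_apply, ← dist_eq_norm]
      refine ContDiffBump.dist_normed_convolution_le hgc.aestronglyMeasurable fun y hy => ?_
      exact (H ((Metric.mem_ball.1 hy).trans hn)).le
    have hs : Function.support (mollify n g - g) ⊆ K := by
      intro x hx
      by_contra hxK
      apply hx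
      have hxR : R + 2 < ‖x‖ := by simpa [K] using hxK
      have hz : ∀ y ∈ Metric.ball x 2, g y = 0 := fun y hy => by
        by_contra h
        have h3 := hR (subset_tsupport g h)
        rw [mem_closedBall_zero_iff] at h3
        rw [mem_ball_iff_norm] at hy
        have := norm_sub_norm_le x y
        rw [norm_sub_rev] at hy
        linarith
      have hx0 : g x = 0 := hz x (Metric.mem_ball_self (by norm_num))
      rw [Pi.sub_apply, hx0, sub_zero, mollify, ContDiffBump.normed_convolution_eq_right, hx0]
      intro y hy
      rw [hx0, hz y (Metric.ball_subset_ball hn' hy)]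
    rw [← eLpNorm_restrict_eq_of_support_subset hs]
    exact eLpNorm_le_of_ae_bound (Eventually.of_forall hd)
  rw [ENNReal.tendsto_nhds_zero]
  intro ε hε
  by_cases hεt : ε = ⊤
  · simp [hεt]
  have hε' : 0 < (ε / (C + 1)).toReal :=
    ENNReal.toReal_pos (ENNReal.div_pos hε.ne' (by simp [hCtop])).ne'
      (ENNReal.div_lt_top hεt (by simp)).ne
  filter_upwards [key _ hε'] with n hn
  refine hn.trans ?_
  rw [ENNReal.ofReal_toReal (ENNReal.div_lt_top hεt (by simp)).ne]
  calc C * (ε / (C + 1)) ≤ (C + 1) * (ε / (C + 1)) := by gcongr; simp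
    _ = ε := ENNReal.mul_div_cancel (by simp) (by simp [hCtop])

/-- Mollifications converge in `L^p`. -/
theorem tendsto_eLpNorm_mollify_sub [CompleteSpace E] {p : ℝ} (hp : 1 ≤ p) {g : Space d → E}
    (hg : MemLp g (ENNReal.ofReal p) volume) :
    Tendsto (fun n => eLpNorm (mollify n g - g) (ENNReal.ofReal p) volume) atTop (𝓝 0) := by
  have hp1 : 1 ≤ ENNReal.ofReal p := by simpa using hp
  rw [ENNReal.tendsto_nhds_zero]
  intro ε hε
  have hε3 : ε / 3 ≠ 0 := (ENNReal.div_pos hε.ne' (by simp)).ne'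
  obtain ⟨h, hhs, hgh, hhc, hhm⟩ :=
    hg.exists_hasCompactSupport_eLpNorm_sub_le ENNReal.ofReal_ne_top hε3
  have h0 := tendsto_eLpNorm_mollify_sub_of_hasCompactSupport (p := ENNReal.ofReal p) hhc hhs
  rw [ENNReal.tendsto_nhds_zero] at h0
  filter_upwards [h0 (ε / 3) (pos_iff_ne_zero.2 hε3)] with n hn
  have hghm := hg.sub hhm
  have e1 : mollify n g - g = mollify n (g - h) + (mollify n h - h) - (g - h) := by
    have := mollify_add (hghm.locallyIntegrable hp1) (hhm.locallyIntegrable hp1) n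
    rw [sub_add_cancel] at this
    rw [this]; abel
  have m1 : AEStronglyMeasurable (mollify n (g - h)) :=
    (contDiff_mollify (hghm.locallyIntegrable hp1) n).continuous.aestronglyMeasurable
  have m2 : AEStronglyMeasurable (mollify n h - h) :=
    ((contDiff_mollify (hhm.locallyIntegrable hp1) n).continuous.sub hhc).aestronglyMeasurable
  rw [e1]
  calc _ ≤ eLpNorm (mollify n (g - h) + (mollify n h - h)) (ENNReal.ofReal p) volume +
        eLpNorm (g - h) (ENNReal.ofReal p) volume :=
        eLpNorm_sub_le (m1.add m2) hghm.1 hp1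
    _ ≤ ε / 3 + ε / 3 + ε / 3 := by
        gcongr
        refine (eLpNorm_add_le m1 m2 hp1).trans ?_
        gcongr
        exact (eLpNorm_mollify_le hp hghm.1 n).trans hgh
    _ = ε := ENNReal.add_thirds ε

/-- The gradient of a mollification is the mollification of the weak gradient. -/
theorem fderiv_mollify {v : Space d → ℝ} {G : Space d → Space d} (h : HasWeakGradient v G)
    (n : ℕ) (x y : Space d) : fderiv ℝ (mollify n v) x y = inner ℝ (mollify n G x) y := by
  obtain ⟨hv, hG, hw⟩ := h
  set b := stdBump (Space d) n
  set ρ := b.normed (volume : Measure (Space d)) with hρ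
  have hρs : HasCompactSupport ρ := b.hasCompactSupport_normed
  have hρd : ContDiff ℝ (⊤ : ℕ∞) ρ := b.contDiff_normed
  have hρ1 : ContDiff ℝ 1 ρ := b.contDiff_normed (n := 1)
  have h1 := (hρs.hasFDerivAt_convolution_left (lsmul ℝ ℝ) hρ1 hv x).fderiv
  have h1' : fderiv ℝ (mollify n v) x =
    convolution (fderiv ℝ ρ) v ((lsmul ℝ ℝ).precompL (Space d)) volume x := h1
  have hex : Integrable fun t => ((lsmul ℝ ℝ : ℝ →L[ℝ] ℝ →L[ℝ] ℝ).precompL (Space d))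
      (fderiv ℝ ρ (x - t)) (v t) :=
    ((hρs.fderiv ℝ).convolutionExists_left _ (hρ1.continuous_fderiv one_ne_zero) hv x).integrable_swap
  -- The reflected kernel serves as test function: the sign from differentiating `x - z` cancels the
  -- one from integration by parts.
  have hφ : IsTestFunction fun z => ρ (x - z) :=
    ⟨hρd.comp (contDiff_const.sub contDiff_id), hρs.comp_homeomorph (Homeomorph.subLeft x)⟩
  have hw' := hw _ hφ y
  have hd : ∀ z, fderiv ℝ (fun z => ρ (x - z)) z y = -fderiv ℝ ρ (x - z) y := fun z => by
    have hc : HasFDerivAt (fun z : Space d => x - z) (-ContinuousLinearMap.id ℝ (Space d)) z := by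
      simpa using (hasFDerivAt_id z).const_sub x
    have := ((hρ1.differentiable one_ne_zero (x - z)).hasFDerivAt.comp z hc).fderiv
    simp only [Function.comp_def] at this
    rw [this]; simp
  have hGi : Integrable fun z => ρ (x - z) • G z :=
    hG.integrable_smul_left_of_hasCompactSupport hφ.1.continuous hφ.2
  rw [h1', convolution_eq_swap, integral_apply hex, mollify_apply, real_inner_comm,
    ← integral_inner hGi]
  simp only [hd, mul_neg, integral_neg, neg_inj] at hw'
  simp only [precompL_apply, lsmul_apply, smul_eq_mul, inner_smul_right, real_inner_comm y] at hw' ⊢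
  simp only [mul_comm (v _)] at hw'
  rw [hw']

end Mollification

end PLaplace

namespace PLaplace

open Filter Topology ContinuousLinearMap

/-! ### Cutoff functions at scale `n + 1`. -/

section Cutoff

variable {d : ℕ}

/-- A smooth bump equal to `1` on the unit ball and supported in the ball of radius `2`. -/
noncomputable def unitBump (d : ℕ) : ContDiffBump (0 : Space d) where
  rIn := 1
  rOut := 2
  rIn_pos := one_pos
  rIn_lt_rOut := one_lt_two

/-- Smooth cutoff functions, equal to `1` on the ball of radius `n + 1`. -/
noncomputable def cutoff (d n : ℕ) (x : Space d) : ℝ :=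
  unitBump d (((n : ℝ) + 1)⁻¹ • x)

theorem cutoff_nonneg (n : ℕ) (x : Space d) : 0 ≤ cutoff d n x := (unitBump d).nonneg

theorem cutoff_le_one (n : ℕ) (x : Space d) : cutoff d n x ≤ 1 := (unitBump d).le_one

theorem cutoff_eq_one {n : ℕ} {x : Space d} (hx : ‖x‖ ≤ n + 1) : cutoff d n x = 1 := by
  refine (unitBump d).one_of_mem_closedBall ?_
  have : (0 : ℝ) < n + 1 := by positivity
  rw [mem_closedBall_zero_iff, norm_smul, norm_inv, Real.norm_of_nonneg this.le,
    inv_mul_le_iff₀ this]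
  simpa [unitBump] using hx

theorem cutoff_eq_zero {n : ℕ} {x : Space d} (hx : 2 * ((n : ℝ) + 1) ≤ ‖x‖) :
    cutoff d n x = 0 := by
  refine (unitBump d).zero_of_le_dist ?_
  have : (0 : ℝ) < n + 1 := by positivity
  rw [dist_zero_right, norm_smul, norm_inv, Real.norm_of_nonneg this.le,
    le_inv_mul_iff₀ this]
  simp only [unitBump]
  linarith

theorem isTestFunction_cutoff (n : ℕ) : IsTestFunction (cutoff d n) := by
  refine ⟨(unitBump d).contDiff.comp (contDiff_const_smul _), ?_⟩
  refine HasCompactSupport.of_support_subset_isCompact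
    (isCompact_closedBall (0 : Space d) (2 * ((n : ℝ) + 1))) fun x hx => ?_
  rw [mem_closedBall_zero_iff]
  by_contra h
  exact hx (cutoff_eq_zero (not_le.1 h).le)

theorem tendsto_cutoff (x : Space d) : Tendsto (fun n => cutoff d n x) atTop (𝓝 1) := by
  refine tendsto_const_nhds.congr' ?_
  filter_upwards [eventually_ge_atTop ⌈‖x‖⌉₊] with n hn
  rw [cutoff_eq_one]
  have := (Nat.le_ceil ‖x‖).trans (Nat.cast_le.2 hn)
  linarith

theorem exists_norm_fderiv_cutoff_le (d : ℕ) :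
    ∃ K : ℝ, 0 ≤ K ∧ ∀ n x, ‖fderiv ℝ (cutoff d n) x‖ ≤ K / (n + 1) := by
  have hc : Continuous (fderiv ℝ (unitBump d : Space d → ℝ)) :=
    ((unitBump d).contDiff (n := 1)).continuous_fderiv one_ne_zero
  obtain ⟨K, hK⟩ := hc.bounded_above_of_compact_support
    ((unitBump d).hasCompactSupport.fderiv ℝ)
  refine ⟨K, (norm_nonneg _).trans (hK 0), fun n x => ?_⟩
  have hn : (0 : ℝ) < n + 1 := by positivity
  have h : HasFDerivAt (cutoff d n) ((fderiv ℝ (unitBump d) (((n : ℝ) + 1)⁻¹ • x)).comp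
      (((n : ℝ) + 1)⁻¹ • ContinuousLinearMap.id ℝ (Space d))) x :=
    ((((unitBump d).contDiff (n := 1)).differentiable one_ne_zero _).hasFDerivAt).comp x
      ((hasFDerivAt_id x).const_smul (((n : ℝ) + 1)⁻¹))
  rw [h.fderiv, comp_smul, comp_id, norm_smul, norm_inv, Real.norm_of_nonneg hn.le, div_eq_inv_mul]
  gcongr
  exact hK _

theorem fderiv_cutoff_eq_zero_of_lt {n : ℕ} {x : Space d} (hx : ‖x‖ < n + 1) :
    fderiv ℝ (cutoff d n) x = 0 := by
  have : cutoff d n =ᶠ[𝓝 x] fun _ => 1 := by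
    filter_upwards [(isOpen_lt continuous_norm continuous_const).mem_nhds hx] with y hy
    exact cutoff_eq_one (le_of_lt hy)
  rw [this.fderiv_eq]; simp

theorem fderiv_cutoff_eq_zero_of_gt {n : ℕ} {x : Space d} (hx : 2 * ((n : ℝ) + 1) < ‖x‖) :
    fderiv ℝ (cutoff d n) x = 0 := by
  have : cutoff d n =ᶠ[𝓝 x] fun _ => 0 := by
    filter_upwards [(isOpen_lt continuous_const continuous_norm).mem_nhds hx] with y hy
    exact cutoff_eq_zero (le_of_lt hy)
  rw [this.fderiv_eq]; simp

theorem tendsto_integral_cutoff_mul {f : Space d → ℝ} (hf : Integrable f) :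
    Tendsto (fun n => ∫ x, cutoff d n x * f x) atTop (𝓝 (∫ x, f x)) := by
  refine tendsto_integral_of_dominated_convergence (fun x => ‖f x‖)
    (fun n => (isTestFunction_cutoff n).1.continuous.aestronglyMeasurable.mul hf.1) hf.norm
    (fun n => Eventually.of_forall fun x => ?_) (Eventually.of_forall fun x => ?_)
  · rw [norm_mul, Real.norm_of_nonneg (cutoff_nonneg _ _)]
    exact mul_le_of_le_one_left (norm_nonneg _) (cutoff_le_one _ _)
  · simpa using (tendsto_cutoff x).mul_const (f x)

end Cutoff

/-- Smooth bounded nondecreasing functions of a real variable which vanish near the origin. -/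
structure IsTruncation (β : ℝ → ℝ) (ε C : ℝ) : Prop where
  contDiff : ContDiff ℝ (⊤ : ℕ∞) β
  deriv_nonneg : ∀ r, 0 ≤ deriv β r
  deriv_le : ∀ r, deriv β r ≤ C
  abs_le : ∀ r, |β r| ≤ C
  eq_zero : ∀ r, |r| ≤ ε → β r = 0

/-! ### Integrability of the flux `|∇v|^{p-2}∇v`. -/

section Flux

variable {d : ℕ} {p : ℝ}

theorem norm_flux (hp : 1 < p) (g : Space d) : ‖‖g‖ ^ (p - 2) • g‖ = ‖g‖ ^ (p - 1) := by
  rw [norm_smul, Real.norm_of_nonneg (by positivity)]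
  -- At `g = 0` the left side is `0` whatever value `0 ^ (p - 2)` takes; the right side is `0`
  -- because `p ≠ 1`.
  rcases eq_or_ne g 0 with rfl | h
  · simp [Real.zero_rpow (by linarith : p - 1 ≠ 0)]
  · rw [show p - 1 = p - 2 + 1 by ring, Real.rpow_add_one (norm_ne_zero_iff.2 h)]

theorem memLp_flux {α : Type*} [MeasurableSpace α] {μ : Measure α} (hp : 1 < p)
    {G : α → Space d} (hG : MemLp G (ENNReal.ofReal p) μ) :
    MemLp (fun x => ‖G x‖ ^ (p - 2) • G x) (ENNReal.ofReal (p / (p - 1))) μ := by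
  have h1 := hG.norm_rpow_div (ENNReal.ofReal (p - 1))
  rw [← ENNReal.ofReal_div_of_pos (by linarith), ENNReal.toReal_ofReal (by linarith)] at h1
  refine h1.mono ((hG.1.norm.aemeasurable.pow_const _).aestronglyMeasurable.smul hG.1)
    (Eventually.of_forall fun x => ?_)
  rw [norm_flux hp]
  exact le_abs_self _

theorem holderConjugate_div (hp : 1 < p) :
    (ENNReal.ofReal p).HolderConjugate (ENNReal.ofReal (p / (p - 1))) :=
  (Real.HolderConjugate.conjExponent hp).ennrealOfReal

theorem integrable_norm_mul_norm {α E E' : Type*} [MeasurableSpace α] {μ : Measure α}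
    [NormedAddCommGroup E] [NormedAddCommGroup E'] (hp : 1 < p)
    {f : α → E} {g : α → E'} (hf : MemLp f (ENNReal.ofReal p) μ)
    (hg : MemLp g (ENNReal.ofReal (p / (p - 1))) μ) :
    Integrable (fun x => ‖f x‖ * ‖g x‖) μ := by
  have := holderConjugate_div hp
  exact hf.norm.integrable_mul hg.norm

end Flux

/-! ### Accretivity against truncations. -/

section Accretive

variable {d : ℕ} {p : ℝ} {v f : Space d → ℝ} {G : Space d → Space d} {β : ℝ → ℝ} {ε C : ℝ}

theorem fderiv_mul_comp_mollify (hv : HasWeakGradient v G) (hβ : IsTruncation β ε C)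
    {χ : Space d → ℝ} (hχ : IsTestFunction χ) (n : ℕ) (x y : Space d) :
    fderiv ℝ (fun x => χ x * β (mollify n v x)) x y =
      χ x * deriv β (mollify n v x) * inner ℝ (mollify n G x) y +
        β (mollify n v x) * fderiv ℝ χ x y := by
  have h1 : HasFDerivAt χ (fderiv ℝ χ x) x := (hχ.1.differentiable (by simp) x).hasFDerivAt
  have h2 : HasFDerivAt (mollify n v) (fderiv ℝ (mollify n v) x) x :=
    ((contDiff_mollify hv.1 n).differentiable (by simp) x).hasFDerivAt
  have h3 : HasDerivAt β (deriv β (mollify n v x)) (mollify n v x) :=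
    (hβ.contDiff.differentiable (by simp) _).hasDerivAt
  have h4 := h1.mul (h3.comp_hasFDerivAt x h2)
  have h5 := h4.fderiv
  simp only [Function.comp_def] at h5
  have h6 : (χ * fun x => β (mollify n v x)) = fun x => χ x * β (mollify n v x) := rfl
  rw [h6] at h5
  rw [h5]
  simp only [add_apply, smul_apply, smul_eq_mul, fderiv_mollify hv]
  ring

/-- Testing `-div F = f` with `χ β(v)`, where `F` is the flux of `∇v`. -/
theorem integral_fderiv_flux_le (hp : 1 < p) (hG : MemLp G (ENNReal.ofReal p) volume)
    (hv : HasWeakGradient v G)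
    (hdiv : HasWeakDivergence (fun x => ‖G x‖ ^ (p - 2) • G x) fun x => -f x)
    (hβ : IsTruncation β ε C) {χ : Space d → ℝ} (hχ : IsTestFunction χ) (hχ0 : ∀ x, 0 ≤ χ x) :
    ∫ x, β (v x) * fderiv ℝ χ x (‖G x‖ ^ (p - 2) • G x) ≤ ∫ x, χ x * (β (v x) * f x) := by
  obtain ⟨hFl, hfl, hdiv⟩ := hdiv
  set F : Space d → Space d := fun x => ‖G x‖ ^ (p - 2) • G x with hF
  have hFm : MemLp F (ENNReal.ofReal (p / (p - 1))) volume := memLp_flux hp hG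
  have hfl' : LocallyIntegrable f :=
    locallyIntegrable_neg_iff.1 hfl
  have hC : 0 ≤ C := (abs_nonneg _).trans (hβ.abs_le 0)
  have hvc : ∀ n, Continuous (mollify n v) := fun n => (contDiff_mollify hv.1 n).continuous
  have hGc : ∀ n, Continuous (mollify n G) := fun n => (contDiff_mollify hv.2.1 n).continuous
  have hχc := hχ.1.continuous
  have hβc := hβ.contDiff.continuous
  have hβ'c : Continuous (deriv β) := hβ.contDiff.continuous_deriv (by simp)
  have hχ'c : Continuous (fderiv ℝ χ) := hχ.1.continuous_fderiv (by simp)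
  obtain ⟨B, hB⟩ := hχc.bounded_above_of_compact_support hχ.2
  have hB0 : 0 ≤ B := (norm_nonneg _).trans (hB 0)
  have hae := ae_tendsto_mollify hv.1
  have hdχi : Integrable fun x => fderiv ℝ χ x (F x) := by
    have h1 : Integrable fun x => ‖fderiv ℝ χ x‖ • F x :=
      hFl.integrable_smul_left_of_hasCompactSupport hχ'c.norm (hχ.2.fderiv ℝ).norm
    refine h1.mono ?_ (Eventually.of_forall fun x => ?_)
    · exact (isBoundedBilinearMap_apply (𝕜 := ℝ)).continuous.comp_aestronglyMeasurable
        (hχ'c.aestronglyMeasurable.prodMk hFm.1)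
    · rw [norm_smul, norm_norm]; exact le_opNorm _ _
  have hχfi : Integrable fun x => χ x * f x :=
    hfl'.integrable_smul_left_of_hasCompactSupport hχc hχ.2
  have hD : ∀ n, Integrable fun x => ‖(mollify n G - G) x‖ * ‖F x‖ := fun n => by
    refine integrable_norm_mul_norm hp ?_ hFm
    have hm : AEStronglyMeasurable (mollify n G) := (hGc n).aestronglyMeasurable
    exact MemLp.sub ⟨hm, (eLpNorm_mollify_le hp.le hG.1 n).trans_lt hG.2⟩ hG
  have hβn : ∀ n, Integrable fun x => β (mollify n v x) * fderiv ℝ χ x (F x) := fun n =>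
    hdχi.bdd_mul (c := C) (hβc.comp (hvc n)).aestronglyMeasurable
      (Eventually.of_forall fun x => hβ.abs_le _)
  have lim1 : Tendsto (fun n => ∫ x, χ x * β (mollify n v x) * f x) atTop
      (𝓝 (∫ x, χ x * (β (v x) * f x))) := by
    refine tendsto_integral_of_dominated_convergence (fun x => C * ‖χ x * f x‖)
      (fun n => ((hχc.mul (hβc.comp (hvc n))).aestronglyMeasurable).mul
        hfl'.aestronglyMeasurable) (hχfi.norm.const_mul C)
      (fun n => Eventually.of_forall fun x => ?_) ?_
    · rw [show χ x * β (mollify n v x) * f x = β (mollify n v x) * (χ x * f x) by ring, norm_mul]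
      gcongr
      exact hβ.abs_le _
    · filter_upwards [hae] with x hx
      have := (((hβc.tendsto _).comp hx).const_mul (χ x)).mul_const (f x)
      simpa [mul_assoc] using this
  have lim2 : Tendsto (fun n => ∫ x, β (mollify n v x) * fderiv ℝ χ x (F x)) atTop
      (𝓝 (∫ x, β (v x) * fderiv ℝ χ x (F x))) := by
    refine tendsto_integral_of_dominated_convergence (fun x => C * ‖fderiv ℝ χ x (F x)‖)
      (fun n => (hβn n).1) (hdχi.norm.const_mul C)
      (fun n => Eventually.of_forall fun x => ?_) ?_
    · rw [norm_mul]
      gcongr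
      exact hβ.abs_le _
    · filter_upwards [hae] with x hx
      exact ((hβc.tendsto _).comp hx).mul_const _
  -- Hölder: the mollified gradients converge in `L^p` and the flux is fixed in `L^{p/(p-1)}`.
  have lim3 : Tendsto (fun n => ∫ x, ‖(mollify n G - G) x‖ * ‖F x‖) atTop (𝓝 0) := by
    have h := tendsto_integral_of_L1' (μ := volume) (fun _ : Space d => (0 : ℝ))
      aestronglyMeasurable_const (l := atTop)
      (F := fun n x => ‖(mollify n G - G) x‖ * ‖F x‖) (Eventually.of_forall hD) ?_
    · simpa using h
    have hb := ENNReal.Tendsto.mul_const (tendsto_eLpNorm_mollify_sub hp.le hG)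
      (Or.inr hFm.2.ne)
    rw [zero_mul] at hb
    refine tendsto_of_tendsto_of_tendsto_of_le_of_le tendsto_const_nhds hb
      (fun _ => zero_le) fun n => ?_
    have := holderConjugate_div hp
    have hm : AEStronglyMeasurable (mollify n G - G) :=
      (hGc n).aestronglyMeasurable.sub hG.1
    have h3 := eLpNorm_smul_le_mul_eLpNorm (p := ENNReal.ofReal p)
      (q := ENNReal.ofReal (p / (p - 1))) (r := 1) hFm.1.norm hm.norm
    rw [eLpNorm_norm, eLpNorm_norm] at h3
    refine le_trans (le_of_eq ?_) h3
    congr 1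
    ext x
    simp
  -- The test function is `χ β(v_n)` with `v_n` mollified. In the term with `β'`, the mollified
  -- gradient is split as `(G_n - G) + G`: the part with `G` has a nonnegative product with the flux
  -- and is dropped, the rest is at most `B C ‖G_n - G‖ ‖F‖`.
  have key : ∀ n, (∫ x, β (mollify n v x) * fderiv ℝ χ x (F x)) -
      B * C * ∫ x, ‖(mollify n G - G) x‖ * ‖F x‖ ≤ ∫ x, χ x * β (mollify n v x) * f x := by
    intro n
    have ht : IsTestFunction fun x => χ x * β (mollify n v x) :=
      ⟨hχ.1.mul (hβ.contDiff.comp (contDiff_mollify hv.1 n)), hχ.2.mul_right⟩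
    have h := hdiv _ ht
    simp only [mul_neg, integral_neg, neg_neg] at h
    rw [← h, ← integral_const_mul, ← integral_sub (hβn n) ((hD n).const_mul _)]
    have hint : Integrable fun x =>
        fderiv ℝ (fun x => χ x * β (mollify n v x)) x (F x) := by
      have hc' : Continuous (fderiv ℝ fun x => χ x * β (mollify n v x)) :=
        ht.1.continuous_fderiv (by simp)
      have h1 : Integrable fun x => ‖fderiv ℝ (fun x => χ x * β (mollify n v x)) x‖ • F x :=
        hFl.integrable_smul_left_of_hasCompactSupport hc'.norm (ht.2.fderiv ℝ).norm
      refine h1.mono ?_ (Eventually.of_forall fun x => ?_)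
      · exact (isBoundedBilinearMap_apply (𝕜 := ℝ)).continuous.comp_aestronglyMeasurable
          (hc'.aestronglyMeasurable.prodMk hFm.1)
      · rw [norm_smul, norm_norm]; exact le_opNorm _ _
    refine integral_mono ((hβn n).sub ((hD n).const_mul _)) hint fun x => ?_
    simp only [fderiv_mul_comp_mollify hv hβ hχ]
    have h1 : inner ℝ (mollify n G x) (F x) =
        inner ℝ ((mollify n G - G) x) (F x) + inner ℝ (G x) (F x) := by
      rw [← inner_add_left, Pi.sub_apply, sub_add_cancel]
    have h2 : 0 ≤ inner ℝ (G x) (F x) := by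
      simp only [hF, inner_smul_right, real_inner_self_eq_norm_sq]
      positivity
    have h3 := (abs_le.1 (abs_real_inner_le_norm ((mollify n G - G) x) (F x))).1
    have h4 := hβ.deriv_nonneg (mollify n v x)
    have h5 := hβ.deriv_le (mollify n v x)
    have h6 : χ x ≤ B := (le_abs_self _).trans (hB x)
    set N := ‖(mollify n G - G) x‖ * ‖F x‖
    have hN : 0 ≤ N := by positivity
    have h7 : χ x * deriv β (mollify n v x) ≤ B * C := mul_le_mul h6 h5 h4 hB0
    have h8 : 0 ≤ χ x * deriv β (mollify n v x) := mul_nonneg (hχ0 x) h4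
    have h9 : -(B * C * N) ≤ χ x * deriv β (mollify n v x) * inner ℝ (mollify n G x) (F x) := by
      rw [h1]
      nlinarith [mul_le_mul_of_nonneg_right h7 hN]
    linarith
  have := le_of_tendsto_of_tendsto (lim2.sub (lim3.const_mul (B * C))) lim1
    (Eventually.of_forall key)
  rwa [mul_zero, sub_zero] at this

theorem IsTruncation.abs_le_mul (hβ : IsTruncation β ε C) (hε : 0 ≤ ε) (r : ℝ) :
    |β r| ≤ C * |r| := by
  have h := Convex.norm_image_sub_le_of_norm_deriv_le (f := β) (s := univ) (C := C) (x := 0)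
    (y := r) (fun x _ => hβ.contDiff.differentiable (by simp) x)
    (fun x _ => by
      rw [Real.norm_of_nonneg (hβ.deriv_nonneg x)]; exact hβ.deriv_le x)
    convex_univ (mem_univ _) (mem_univ _)
  rw [hβ.eq_zero 0 (by simpa using hε), sub_zero, sub_zero] at h
  exact h

theorem IsTruncation.memLp_comp (hβ : IsTruncation β ε C) (hε : 0 ≤ ε) {v : Space d → ℝ}
    {q : ENNReal} (hv : MemLp v q volume) : MemLp (fun x => β (v x)) q volume := by
  refine (hv.const_mul C).mono (hβ.contDiff.continuous.comp_aestronglyMeasurable hv.1)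
    (Eventually.of_forall fun x => ?_)
  have hC : 0 ≤ C := (abs_nonneg _).trans (hβ.abs_le 0)
  simpa [abs_of_nonneg hC] using hβ.abs_le_mul hε (v x)

/-- Here it matters that truncations vanish near `0`: `β(v)` is bounded by `C` and vanishes off
`{|v| ≥ ε}`, which has finite measure by Chebyshev. The case `q = p` makes `β(v)` pair with the
flux. -/
theorem IsTruncation.memLp_comp_of_memLp_two (hβ : IsTruncation β ε C) (hε : 0 < ε)
    {v : Space d → ℝ} (hv : MemLp v 2 volume) (q : ENNReal) :
    MemLp (fun x => β (v x)) q volume := by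
  wlog hvm : StronglyMeasurable v generalizing v
  · have h := hv.1.ae_eq_mk
    have := this ((memLp_congr_ae h).1 hv) hv.1.stronglyMeasurable_mk
    refine (memLp_congr_ae ?_).2 this
    filter_upwards [h] with x hx
    rw [hx]
  have hfin := hv.meas_ge_lt_top (by norm_num) (by norm_num) (ε := ε.toNNReal)
    (by simpa using hε)
  have hC : 0 ≤ C := (abs_nonneg _).trans (hβ.abs_le 0)
  set S := {x | ε.toNNReal ≤ ‖v x‖₊} with hS
  have hSm : MeasurableSet S := measurableSet_le measurable_const hvm.measurable.nnnorm
  have h1 : MemLp (S.indicator fun _ => C) q volume :=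
    memLp_indicator_const q hSm C (Or.inr hfin.ne)
  refine h1.mono (hβ.contDiff.continuous.comp_aestronglyMeasurable hv.1)
    (Eventually.of_forall fun x => ?_)
  by_cases hx : x ∈ S
  · rw [indicator_of_mem hx, Real.norm_of_nonneg hC]
    exact hβ.abs_le _
  · have : |v x| ≤ ε := by
      have hx' : ‖v x‖₊ < ε.toNNReal := not_le.1 hx
      rw [Real.lt_toNNReal_iff_coe_lt] at hx'
      exact hx'.le
    rw [hβ.eq_zero _ this]
    simp

/-- Accretivity of the `p`-Laplacian: `⟨A v, β(v)⟩ ≥ 0`. -/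
theorem IsNegPLaplacian.integral_truncation_mul_nonneg (hp : 1 < p) {v f : L2 d}
    (h : IsNegPLaplacian p v f) (hβ : IsTruncation β ε C) (hε : 0 < ε) :
    0 ≤ ∫ x, β (v x) * f x := by
  obtain ⟨G, hG, hv, hdiv⟩ := h
  have hvm := Lp.memLp v
  have hfm := Lp.memLp f
  set F : Space d → Space d := fun x => ‖G x‖ ^ (p - 2) • G x with hF
  have hFm : MemLp F (ENNReal.ofReal (p / (p - 1))) volume := memLp_flux hp hG
  have hβF : Integrable fun x => ‖β (v x)‖ * ‖F x‖ :=
    integrable_norm_mul_norm hp (hβ.memLp_comp_of_memLp_two hε hvm _) hFm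
  have hβf : Integrable fun x => β (v x) * f x := (hβ.memLp_comp hε.le hvm).integrable_mul hfm
  obtain ⟨K, hK0, hK⟩ := exists_norm_fderiv_cutoff_le d
  -- The cutoff error is `O(1/n)` because `β(v) F` is integrable; no relation between `p` and `d`
  -- enters.
  have key : ∀ n : ℕ, -(K / (n + 1) * ∫ x, ‖β (v x)‖ * ‖F x‖) ≤
      ∫ x, cutoff d n x * (β (v x) * f x) := by
    intro n
    refine le_trans ?_ (integral_fderiv_flux_le hp hG hv hdiv hβ (isTestFunction_cutoff n)
      (cutoff_nonneg n))
    rw [neg_le, ← integral_neg, ← integral_const_mul]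
    have hb : ∀ x, ‖-(β (v x) * fderiv ℝ (cutoff d n) x (F x))‖ ≤
        K / (n + 1) * (‖β (v x)‖ * ‖F x‖) := fun x => by
      rw [norm_neg, norm_mul]
      calc _ ≤ ‖β (v x)‖ * (‖fderiv ℝ (cutoff d n) x‖ * ‖F x‖) := by
            gcongr; exact le_opNorm _ _
        _ ≤ ‖β (v x)‖ * (K / (n + 1) * ‖F x‖) := by gcongr; exact hK n x
        _ = _ := by ring
    exact (le_abs_self _).trans
      (norm_integral_le_of_norm_le (hβF.const_mul _) (Eventually.of_forall hb))
  have lim : Tendsto (fun n : ℕ => -(K / ((n : ℝ) + 1) * ∫ x, ‖β (v x)‖ * ‖F x‖)) atTop (𝓝 0) := by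
    have h0 := ((tendsto_one_div_add_atTop_nhds_zero_nat (𝕜 := ℝ)).const_mul
      (K * ∫ x, ‖β (v x)‖ * ‖F x‖)).neg
    rw [mul_zero, neg_zero] at h0
    refine h0.congr fun n => ?_
    ring
  exact le_of_tendsto_of_tendsto lim (tendsto_integral_cutoff_mul hβf) (Eventually.of_forall key)

end Accretive

end PLaplace

namespace PLaplace

open Filter Topology

/-! ### Integrating a differential inequality up to the endpoints. -/

section Monotonicity

/-- Absolute continuity holds only on compact subintervals of `(0, T)`, since the solution is
`W^{1,2}` only away from time `0`. The bound is proved there and passes to both endpoints by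
continuity; nonnegativity of `h` makes it uniform in the subinterval. -/
theorem sub_le_setIntegral_of_ae_hasDerivAt_le {T : ℝ} (hT : 0 < T) {f h : ℝ → ℝ}
    (hc : ContinuousOn f (Icc 0 T))
    (hac : ∀ s t, 0 < s → s ≤ t → t < T → AbsolutelyContinuousOnInterval f s t)
    (hh : IntegrableOn h (Ioo 0 T)) (h0 : ∀ᵐ t ∂(volume.restrict (Ioo 0 T)), 0 ≤ h t)
    (hd : ∀ᵐ t ∂(volume.restrict (Ioo 0 T)), ∃ d ≤ h t, HasDerivAt f d t) {t : ℝ}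
    (ht : t ∈ Icc 0 T) : f t - f 0 ≤ ∫ r in Ioo 0 T, h r := by
  set K := ∫ r in Ioo 0 T, h r
  have hK : 0 ≤ K := integral_nonneg_of_ae h0
  have key : ∀ s t, 0 < s → s ≤ t → t < T → f t - f s ≤ K := by
    intro s t hs hst ht
    have hsub : Ioo s t ⊆ Ioo 0 T := Ioo_subset_Ioo hs.le ht.le
    have hsub' : Ioc s t ⊆ Ioo 0 T := fun x hx => ⟨hs.trans hx.1, hx.2.trans_lt ht⟩
    refine (sub_le_integral_of_ae_hasDerivAt_le hst (hac s t hs hst ht)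
      ((intervalIntegrable_iff_integrableOn_Ioc_of_le hst).2 (hh.mono_set hsub'))
      (ae_restrict_of_ae_restrict_of_subset hsub hd)).trans ?_
    rw [intervalIntegral.integral_of_le hst]
    exact setIntegral_mono_set hh h0 hsub'.eventuallyLE
  have key2 : ∀ t ∈ Ioo 0 T, f t - f 0 ≤ K := by
    intro t ht
    have h1 : (0 : ℝ) ∈ closure (Ioo 0 t) := by
      rw [closure_Ioo ht.1.ne]; exact left_mem_Icc.2 ht.1.le
    have hsub : Ioo 0 t ⊆ Icc 0 T := Ioo_subset_Icc_self.trans (Icc_subset_Icc_right ht.2.le)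
    have h2 : ContinuousWithinAt f (Ioo 0 t) 0 := (hc 0 (left_mem_Icc.2 hT.le)).mono hsub
    exact ContinuousWithinAt.closure_le h1 (f := fun s => f t - f s) (g := fun _ => K)
      (continuousWithinAt_const.sub h2) continuousWithinAt_const
      fun s hs => key s t hs.1 hs.2.le ht.2
  have h1 : t ∈ closure (Ioo 0 T) := by rwa [closure_Ioo hT.ne]
  exact ContinuousWithinAt.closure_le h1 (f := fun s => f s - f 0) (g := fun _ => K)
      (((hc t ht).mono Ioo_subset_Icc_self).sub continuousWithinAt_const) continuousWithinAt_const
      key2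

end Monotonicity

/-! ### Decay of the energies `∫ j(u(t))`. -/

section Energy

variable {d : ℕ} {β : ℝ → ℝ} {ε C : ℝ}

/-- The primitive of `β` vanishing at the origin. -/
noncomputable def primitive (β : ℝ → ℝ) (r : ℝ) : ℝ := ∫ s in (0 : ℝ)..r, β s

theorem hasDerivAt_primitive (hβ : Continuous β) (r : ℝ) :
    HasDerivAt (primitive β) (β r) r :=
  intervalIntegral.integral_hasDerivAt_right (hβ.intervalIntegrable 0 r)
    (hβ.stronglyMeasurableAtFilter _ _) hβ.continuousAt

theorem continuous_primitive (hβ : Continuous β) : Continuous (primitive β) :=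
  continuous_iff_continuousAt.2 fun r => (hasDerivAt_primitive hβ r).continuousAt

theorem primitive_zero : primitive β 0 = 0 := by simp [primitive]

namespace IsTruncation

theorem nonneg_const (hβ : IsTruncation β ε C) : 0 ≤ C := (abs_nonneg _).trans (hβ.abs_le 0)

theorem abs_sub_le (hβ : IsTruncation β ε C) (a b : ℝ) : |β a - β b| ≤ C * |a - b| :=
  Convex.norm_image_sub_le_of_norm_deriv_le (f := β) (s := univ) (C := C)
    (fun x _ => hβ.contDiff.differentiable (by simp) x)
    (fun x _ => by rw [Real.norm_of_nonneg (hβ.deriv_nonneg x)]; exact hβ.deriv_le x)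
    convex_univ (mem_univ _) (mem_univ _)

theorem abs_primitive_sub_le (hβ : IsTruncation β ε C) (a b : ℝ) :
    |primitive β a - primitive β b - β b * (a - b)| ≤ C * (a - b) ^ 2 := by
  have hd : ∀ r ∈ uIcc b a, HasDerivWithinAt (fun r => primitive β r - β b * r) (β r - β b)
      (uIcc b a) r := fun r _ => by
    have := (hasDerivAt_primitive hβ.contDiff.continuous r).sub
      ((hasDerivAt_id r).const_mul (β b))
    rw [mul_one] at this
    exact this.hasDerivWithinAt
  have h := Convex.norm_image_sub_le_of_norm_hasDerivWithin_le (C := C * |a - b|) hd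
    (fun r hr => (hβ.abs_sub_le r b).trans (
      mul_le_mul_of_nonneg_left (abs_sub_left_of_mem_uIcc hr) hβ.nonneg_const)) (convex_uIcc b a)
    left_mem_uIcc right_mem_uIcc
  rw [Real.norm_eq_abs, Real.norm_eq_abs, mul_assoc, ← pow_two, sq_abs] at h
  convert h using 2
  ring

theorem abs_primitive_le (hβ : IsTruncation β ε C) (hε : 0 ≤ ε) (r : ℝ) :
    |primitive β r| ≤ C * r ^ 2 := by
  have := hβ.abs_primitive_sub_le r 0
  rwa [primitive_zero, hβ.eq_zero 0 (by simpa using hε), sub_zero, sub_zero, zero_mul,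
    sub_zero] at this

theorem integrable_primitive_comp (hβ : IsTruncation β ε C) (hε : 0 ≤ ε) {v : Space d → ℝ}
    (hv : MemLp v 2 volume) : Integrable fun x => primitive β (v x) := by
  refine (hv.integrable_sq.const_mul C).mono
    ((continuous_primitive hβ.contDiff.continuous).comp_aestronglyMeasurable hv.1)
    (Eventually.of_forall fun x => ?_)
  exact (hβ.abs_primitive_le hε _).trans (le_abs_self _)

end IsTruncation

/-- The convex functional `v ↦ ∫ j(v)` with `j' = β`. -/
noncomputable def energy (β : ℝ → ℝ) (v : L2 d) : ℝ := ∫ x, primitive β (v x)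

theorem norm_sq_eq_integral (v : L2 d) : ‖v‖ ^ 2 = ∫ x, v x ^ 2 := by
  rw [← real_inner_self_eq_norm_sq, L2.inner_def]
  simp [pow_two]

namespace IsTruncation

/-- The first-order Taylor estimate for `j`, with quadratic remainder because `β` is `C`-Lipschitz,
is integrated over space. So the energy is Fréchet differentiable on `L²` with gradient `β(v)`. -/
theorem abs_energy_sub_le (hβ : IsTruncation β ε C) (hε : 0 ≤ ε) (w v : L2 d) :
    |energy β w - energy β v -
      inner ℝ ((hβ.memLp_comp hε (Lp.memLp v)).toLp (fun x => β (v x))) (w - v)| ≤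
        C * ‖w - v‖ ^ 2 := by
  have hw := Lp.memLp w
  have hv := Lp.memLp v
  have hβv := hβ.memLp_comp hε hv
  have hjw := hβ.integrable_primitive_comp hε hw
  have hjv := hβ.integrable_primitive_comp hε hv
  have hp : Integrable fun x => β (v x) * (w x - v x) := hβv.integrable_mul (hw.sub hv)
  have e1 : inner ℝ (hβv.toLp (fun x => β (v x))) (w - v) = ∫ x, β (v x) * (w x - v x) := by
    rw [L2.inner_def]
    refine integral_congr_ae ?_
    filter_upwards [hβv.coeFn_toLp, Lp.coeFn_sub w v] with x h1 h2
    rw [h1, h2]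
    simp [mul_comm]
  have e2 : ‖w - v‖ ^ 2 = ∫ x, (w x - v x) ^ 2 := by
    rw [norm_sq_eq_integral]
    refine integral_congr_ae ?_
    filter_upwards [Lp.coeFn_sub w v] with x h2
    rw [h2, Pi.sub_apply]
  rw [e1, e2, energy, energy, ← integral_sub hjw hjv, ← integral_sub (f := fun x => _ - _) (hjw.sub hjv) hp,
    ← integral_const_mul, ← Real.norm_eq_abs]
  have hsq : Integrable fun x => C * (w x - v x) ^ 2 := (hw.sub hv).integrable_sq.const_mul C
  exact norm_integral_le_of_norm_le hsq
    (Eventually.of_forall fun x => hβ.abs_primitive_sub_le (w x) (v x))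

theorem hasFDerivAt_energy (hβ : IsTruncation β ε C) (hε : 0 ≤ ε) (v : L2 d) :
    HasFDerivAt (energy β)
      (innerSL ℝ ((hβ.memLp_comp hε (Lp.memLp v)).toLp (fun x => β (v x)))) v := by
  rw [hasFDerivAt_iff_isLittleO]
  have h1 : (fun w : L2 d => energy β w - energy β v -
      innerSL ℝ ((hβ.memLp_comp hε (Lp.memLp v)).toLp (fun x => β (v x))) (w - v)) =O[𝓝 v]
      fun w => ‖w - v‖ ^ 2 :=
    Asymptotics.IsBigO.of_bound C (Eventually.of_forall fun w => by
      rw [norm_pow, norm_norm]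
      exact hβ.abs_energy_sub_le hε w v)
  refine h1.trans_isLittleO ?_
  have h2 : Tendsto (fun w : L2 d => w - v) (𝓝 v) (𝓝 0) := by
    have h3 : Continuous fun w : L2 d => w - v := by fun_prop
    simpa using h3.tendsto v
  exact (Asymptotics.isLittleO_norm_pow_id one_lt_two).comp_tendsto h2

/-- Lipschitz on balls, so that composing with the absolutely continuous curve `u` preserves
absolute continuity. In the constant, `C M` comes from the gradient and `2 C M` from the quadratic
remainder. -/
theorem dist_energy_le (hβ : IsTruncation β ε C) (hε : 0 ≤ ε) {M : ℝ} {w v : L2 d}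
    (hw : ‖w‖ ≤ M) (hv : ‖v‖ ≤ M) : dist (energy β w) (energy β v) ≤ 3 * C * M * dist w v := by
  have h := hβ.abs_energy_sub_le hε w v
  set b := (hβ.memLp_comp hε (Lp.memLp v)).toLp (fun x => β (v x))
  have hC := hβ.nonneg_const
  have hb : ‖b‖ ≤ C * M := by
    refine le_trans (Lp.norm_le_mul_norm_of_ae_le_mul (c := C) (g := v) ?_) (by gcongr)
    filter_upwards [(hβ.memLp_comp hε (Lp.memLp v)).coeFn_toLp] with x hx
    rw [hx]
    exact hβ.abs_le_mul hε _
  have h1 := abs_real_inner_le_norm b (w - v)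
  rw [Real.dist_eq, dist_eq_norm]
  have h2 : ‖w - v‖ ≤ 2 * M := (norm_sub_le _ _).trans (by linarith)
  have h3 : ‖b‖ * ‖w - v‖ ≤ C * M * ‖w - v‖ := by gcongr
  have h4 : C * ‖w - v‖ ^ 2 ≤ C * (2 * M) * ‖w - v‖ := by
    rw [pow_two, ← mul_assoc]; gcongr
  have h5 := abs_sub_abs_le_abs_sub (energy β w - energy β v) (inner ℝ b (w - v))
  linarith

end IsTruncation

variable {p T : ℝ} {u₀ : L2 d} {u : ℝ → L2 d}

theorem IsWeakSolution.absolutelyContinuousOnInterval (hu : IsWeakSolution p T u₀ u) {s t : ℝ}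
    (hs : 0 < s) (hst : s ≤ t) (ht : t < T) : AbsolutelyContinuousOnInterval u s t :=
  (hu.memW12 (s / 2) (by linarith) (by linarith)).absolutelyContinuousOnInterval
    (hu.continuousOn.mono (Icc_subset_Icc_left (by linarith))) (by linarith) hst ht

/-- The functionals `∫ j(u(t))` do not increase along a weak solution. -/
theorem IsWeakSolution.energy_le (hp : 1 < p) (hT : 0 < T) (hu : IsWeakSolution p T u₀ u)
    (hβ : IsTruncation β ε C) (hε : 0 < ε) {t : ℝ} (ht : t ∈ Icc 0 T) :
    energy β (u t) ≤ energy β u₀ := by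
  obtain ⟨M, hM⟩ := isCompact_Icc.exists_bound_of_continuousOn hu.continuousOn
  obtain ⟨a, -, ha⟩ := hu.equation
  have hcont : Continuous (energy β : L2 d → ℝ) :=
    continuous_iff_continuousAt.2 fun v => (hβ.hasFDerivAt_energy hε.le v).continuousAt
  have h := sub_le_setIntegral_of_ae_hasDerivAt_le hT (f := fun t => energy β (u t))
    (h := fun _ => 0) (hcont.comp_continuousOn hu.continuousOn)
    (fun s t hs hst ht => absolutelyContinuousOnInterval_of_lipschitz_comp
      (hu.absolutelyContinuousOnInterval hs hst ht) fun x hx y hy => by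
        rw [uIcc_of_le hst] at hx hy
        exact hβ.dist_energy_le hε.le (hM x ⟨hs.le.trans hx.1, hx.2.trans ht.le⟩)
          (hM y ⟨hs.le.trans hy.1, hy.2.trans ht.le⟩))
    integrableOn_zero (by simp) ?_ ht
  · simp only [integral_zero, hu.initial] at h
    linarith
  · filter_upwards [ha] with t ht
    -- Chain rule: the derivative is `-⟨β(u), A u⟩`, nonpositive by accretivity.
    refine ⟨_, ?_, (hβ.hasFDerivAt_energy hε.le (u t)).comp_hasDerivAt t ht.2⟩
    rw [map_neg, neg_nonpos, innerSL_apply_apply, L2.inner_def]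
    refine (ht.1.integral_truncation_mul_nonneg hp hβ hε).trans_eq (integral_congr_ae ?_)
    filter_upwards [(hβ.memLp_comp hε.le (Lp.memLp (u t))).coeFn_toLp] with x hx
    rw [hx]
    simp [mul_comm]

end Energy

end PLaplace

namespace PLaplace

open Filter Topology

/-! ### Smooth steps and their primitives. -/

section Step

theorem exists_deriv_smoothTransition_le : ∃ D, ∀ r, deriv Real.smoothTransition r ≤ D := by
  have hc : Continuous (deriv Real.smoothTransition) :=
    (Real.smoothTransition.contDiff (n := 1)).continuous_deriv le_rfl
  have hs : HasCompactSupport (deriv Real.smoothTransition) := by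
    refine HasCompactSupport.of_support_subset_isCompact (isCompact_Icc (a := (0 : ℝ)) (b := 1))
      fun r hr => ?_
    by_contra h
    apply hr
    rw [mem_Icc, not_and_or, not_le, not_le] at h
    rcases h with h | h
    · have : Real.smoothTransition =ᶠ[𝓝 r] fun _ => 0 := by
        filter_upwards [Iio_mem_nhds h] with s hs
        exact Real.smoothTransition.zero_of_nonpos (le_of_lt hs)
      rw [this.deriv_eq]; simp
    · have : Real.smoothTransition =ᶠ[𝓝 r] fun _ => 1 := by
        filter_upwards [Ioi_mem_nhds h] with s hs
        exact Real.smoothTransition.one_of_one_le (le_of_lt hs)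
      rw [this.deriv_eq]; simp
  obtain ⟨D, hD⟩ := hc.bounded_above_of_compact_support hs
  exact ⟨D, fun r => (le_abs_self _).trans (hD r)⟩

/-- A smooth step, equal to `0` on `(-∞, m]` and to `1` on `[2m, ∞)`. -/
noncomputable def step (m r : ℝ) : ℝ := Real.smoothTransition (m⁻¹ * r - 1)

theorem step_nonneg (m r : ℝ) : 0 ≤ step m r := Real.smoothTransition.nonneg _

theorem step_le_one (m r : ℝ) : step m r ≤ 1 := Real.smoothTransition.le_one _

variable {m : ℝ}

theorem step_eq_zero (hm : 0 < m) {r : ℝ} (hr : r ≤ m) : step m r = 0 := by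
  refine Real.smoothTransition.zero_of_nonpos ?_
  rw [sub_nonpos, inv_mul_le_iff₀ hm]
  linarith

theorem step_pos (hm : 0 < m) {r : ℝ} (hr : m < r) : 0 < step m r := by
  refine Real.smoothTransition.pos_of_pos ?_
  rw [sub_pos, lt_inv_mul_iff₀ hm]
  linarith

theorem step_eq_one (hm : 0 < m) {r : ℝ} (hr : 2 * m ≤ r) : step m r = 1 := by
  refine Real.smoothTransition.one_of_one_le ?_
  rw [le_sub_iff_add_le, le_inv_mul_iff₀ hm]
  linarith

theorem contDiff_step (m : ℝ) : ContDiff ℝ (⊤ : ℕ∞) (step m) :=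
  Real.smoothTransition.contDiff.comp ((contDiff_const.mul contDiff_id).sub contDiff_const)

/-- The constant blows up as `m → 0`, harmlessly: the energy inequality does not contain it. -/
theorem exists_isTruncation_step (hm : 0 < m) : ∃ C, IsTruncation (step m) m C := by
  obtain ⟨D, hD⟩ := exists_deriv_smoothTransition_le
  have hd : ∀ r, deriv (step m) r = m⁻¹ * deriv Real.smoothTransition (m⁻¹ * r - 1) := fun r => by
    have h1 : HasDerivAt (fun r : ℝ => m⁻¹ * r - 1) m⁻¹ r := by
      simpa using ((hasDerivAt_id r).const_mul m⁻¹).sub_const 1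
    have h2 := ((Real.smoothTransition.contDiff (n := 1)).differentiable one_ne_zero
      (m⁻¹ * r - 1)).hasDerivAt.comp r h1
    rw [mul_comm]
    exact h2.deriv
  refine ⟨max 1 (m⁻¹ * D), contDiff_step m, fun r => ?_, fun r => ?_, fun r => ?_, fun r hr => ?_⟩
  · rw [hd]
    have := Real.smoothTransition.monotone.deriv_nonneg (x := m⁻¹ * r - 1)
    positivity
  · rw [hd]
    refine le_trans ?_ (le_max_right _ _)
    gcongr
    exact hD _
  · rw [abs_of_nonneg (step_nonneg _ _)]
    exact (step_le_one _ _).trans (le_max_left _ _)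
  · exact step_eq_zero hm ((le_abs_self r).trans hr)

theorem IsTruncation.reflect {β : ℝ → ℝ} {ε C : ℝ} (hβ : IsTruncation β ε C) :
    IsTruncation (fun r => -β (-r)) ε C := by
  have hd : ∀ r, deriv (fun r => -β (-r)) r = deriv β (-r) := fun r => by
    have h := ((hβ.contDiff.differentiable (by simp) (-r)).hasDerivAt.comp r
      (hasDerivAt_neg r)).neg
    simpa [Function.comp_def] using h.deriv
  refine ⟨(hβ.contDiff.comp contDiff_neg).neg, fun r => ?_, fun r => ?_, fun r => ?_,
    fun r hr => ?_⟩
  · rw [hd]; exact hβ.deriv_nonneg _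
  · rw [hd]; exact hβ.deriv_le _
  · rw [abs_neg]; exact hβ.abs_le _
  · rw [hβ.eq_zero _ (by rwa [abs_neg]), neg_zero]

theorem primitive_reflect (β : ℝ → ℝ) (r : ℝ) :
    primitive (fun r => -β (-r)) r = primitive β (-r) := by
  rw [primitive, primitive, intervalIntegral.integral_neg, intervalIntegral.integral_comp_neg,
    intervalIntegral.integral_symm]
  simp

theorem continuous_step (m : ℝ) : Continuous (step m) := (contDiff_step m).continuous

theorem primitive_step_eq_zero (hm : 0 < m) {r : ℝ} (hr : r ≤ m) : primitive (step m) r = 0 := by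
  rw [primitive, intervalIntegral.integral_congr (g := fun _ => 0), intervalIntegral.integral_zero]
  intro s hs
  refine step_eq_zero hm ?_
  rcases mem_uIcc.1 hs with h | h <;> linarith [h.2]

theorem primitive_step_nonneg (hm : 0 < m) (r : ℝ) : 0 ≤ primitive (step m) r := by
  rcases le_total r m with h | h
  · rw [primitive_step_eq_zero hm h]
  · exact intervalIntegral.integral_nonneg (by linarith) fun s _ => step_nonneg _ _

theorem primitive_step_le (hm : 0 < m) (r : ℝ) : primitive (step m) r ≤ max r 0 := by
  rcases le_total r m with h | h
  · rw [primitive_step_eq_zero hm h]; exact le_max_right _ _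
  · refine le_trans ?_ (le_max_left _ _)
    have h1 := intervalIntegral.integral_mono_on (μ := volume) (a := 0) (b := r) (by linarith)
      ((continuous_step m).intervalIntegrable _ _) (continuous_const (y := (1 : ℝ)).intervalIntegrable _ _)
      fun s _ => step_le_one m s
    simpa [primitive] using h1

/-- With `primitive_step_le`, this pinches the primitive to the positive part of `r` as `m → 0`. -/
theorem sub_le_primitive_step (hm : 0 < m) (r : ℝ) : r - 2 * m ≤ primitive (step m) r := by
  rcases le_total r (2 * m) with h | h
  · exact le_trans (by linarith) (primitive_step_nonneg hm r)
  · have hi := fun a b => (continuous_step m).intervalIntegrable (μ := volume) a b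
    rw [primitive, ← intervalIntegral.integral_add_adjacent_intervals (hi 0 (2 * m)) (hi (2 * m) r)]
    have h1 : 0 ≤ ∫ s in (0 : ℝ)..(2 * m), step m s :=
      intervalIntegral.integral_nonneg (by linarith) fun s _ => step_nonneg _ _
    have h2 : ∫ s in (2 * m)..r, step m s = r - 2 * m := by
      rw [intervalIntegral.integral_congr (g := fun _ => 1)]
      · simp
      · intro s hs
        rw [uIcc_of_le h] at hs
        exact step_eq_one hm hs.1
    linarith

theorem primitive_step_pos (hm : 0 < m) {r : ℝ} (hr : m < r) : 0 < primitive (step m) r := by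
  refine intervalIntegral.integral_pos (by linarith) (continuous_step m).continuousOn
    (fun s _ => step_nonneg _ _) ⟨r, ⟨by linarith, le_rfl⟩, step_pos hm hr⟩

end Step

/-! ### From energies of steps to sup and `L¹` bounds. -/

section Comparison

variable {α : Type*} [MeasurableSpace α] {μ : Measure α} {a b : α → ℝ}

/-- Domination of `b` by `a` in the sense of all energies of smooth steps. -/
def StepDominated (μ : Measure α) (b a : α → ℝ) : Prop :=
  ∀ m > 0, Integrable (fun x => primitive (step m) (b x)) μ ∧
    Integrable (fun x => primitive (step m) (a x)) μ ∧
    ∫ x, primitive (step m) (b x) ∂μ ≤ ∫ x, primitive (step m) (a x) ∂μ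

theorem StepDominated.ae_le (h : StepDominated μ b a) {M : ℝ} (hM : 0 ≤ M)
    (ha : ∀ᵐ x ∂μ, a x ≤ M) : ∀ᵐ x ∂μ, b x ≤ M := by
  -- The shift keeps the threshold positive even for `M = 0`. At this threshold the energy of `a` is
  -- zero, hence so is that of `b`, whose integrand is positive above the threshold.
  have key : ∀ n : ℕ, ∀ᵐ x ∂μ, b x ≤ M + 1 / ((n : ℝ) + 1) := by
    intro n
    have hn : (0 : ℝ) < 1 / ((n : ℝ) + 1) := by positivity
    have hm : 0 < M + 1 / ((n : ℝ) + 1) := by positivity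
    set m := M + 1 / ((n : ℝ) + 1)
    obtain ⟨hb, -, hle⟩ := h m hm
    have h0 : ∫ x, primitive (step m) (a x) ∂μ = 0 := by
      refine integral_eq_zero_of_ae ?_
      filter_upwards [ha] with x hx
      exact primitive_step_eq_zero hm (by linarith)
    have h1 : ∫ x, primitive (step m) (b x) ∂μ = 0 :=
      le_antisymm (hle.trans_eq h0) (integral_nonneg fun x => primitive_step_nonneg hm _)
    rw [integral_eq_zero_iff_of_nonneg (fun x => primitive_step_nonneg hm _) hb] at h1
    filter_upwards [h1] with x hx
    by_contra hlt
    exact (primitive_step_pos hm (not_le.1 hlt)).ne' hx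
  filter_upwards [ae_all_iff.2 key] with x hx
  have := (tendsto_one_div_add_atTop_nhds_zero_nat (𝕜 := ℝ)).const_add M
  rw [add_zero] at this
  exact ge_of_tendsto' this hx

/-- Fatou as `m → 0`, with the lower bound on the primitive for `b` and the upper one for `a`. In
`[0, ∞]` no integrability of `a` or `b` is required. -/
theorem StepDominated.lintegral_le (h : StepDominated μ b a) :
    ∫⁻ x, ENNReal.ofReal (b x) ∂μ ≤ ∫⁻ x, ENNReal.ofReal (a x) ∂μ := by
  set m : ℕ → ℝ := fun n => 1 / ((n : ℝ) + 1) with hm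
  have hm0 : ∀ n, 0 < m n := fun n => by positivity
  have hmt : Tendsto m atTop (𝓝 0) := tendsto_one_div_add_atTop_nhds_zero_nat
  have hlim : ∀ x, ENNReal.ofReal (b x) ≤
      liminf (fun n => ENNReal.ofReal (primitive (step (m n)) (b x))) atTop := by
    intro x
    have h1 : Tendsto (fun n => ENNReal.ofReal (b x - 2 * m n)) atTop
        (𝓝 (ENNReal.ofReal (b x))) := by
      refine (ENNReal.continuous_ofReal.tendsto _).comp ?_
      simpa using (hmt.const_mul 2).const_sub (b x)
    rw [← h1.liminf_eq]
    exact liminf_le_liminf (Eventually.of_forall fun n =>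
      ENNReal.ofReal_le_ofReal (sub_le_primitive_step (hm0 n) _))
  calc ∫⁻ x, ENNReal.ofReal (b x) ∂μ
      ≤ ∫⁻ x, liminf (fun n => ENNReal.ofReal (primitive (step (m n)) (b x))) atTop ∂μ :=
        lintegral_mono hlim
    _ ≤ liminf (fun n => ∫⁻ x, ENNReal.ofReal (primitive (step (m n)) (b x)) ∂μ) atTop :=
        lintegral_liminf_le' fun n => (h (m n) (hm0 n)).1.aemeasurable.ennreal_ofReal
    _ ≤ liminf (fun _ : ℕ => ∫⁻ x, ENNReal.ofReal (a x) ∂μ) atTop := by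
        refine liminf_le_liminf (Eventually.of_forall fun n => ?_)
        obtain ⟨hb, ha, hle⟩ := h (m n) (hm0 n)
        rw [← ofReal_integral_eq_lintegral_ofReal hb
          (Eventually.of_forall fun x => primitive_step_nonneg (hm0 n) _)]
        refine (ENNReal.ofReal_le_ofReal hle).trans ?_
        rw [ofReal_integral_eq_lintegral_ofReal ha
          (Eventually.of_forall fun x => primitive_step_nonneg (hm0 n) _)]
        refine lintegral_mono fun x => ?_
        refine (ENNReal.ofReal_le_ofReal (primitive_step_le (hm0 n) _)).trans ?_
        rw [ENNReal.ofReal_max, ENNReal.ofReal_zero]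
        simp
    _ = _ := by simp

end Comparison

/-! ### Bounds for weak solutions. -/

section Solution

variable {d : ℕ} {p T : ℝ} {u₀ : L2 d} {u : ℝ → L2 d}

theorem IsWeakSolution.stepDominated (hp : 1 < p) (hT : 0 < T) (hu : IsWeakSolution p T u₀ u)
    {t : ℝ} (ht : t ∈ Icc 0 T) : StepDominated volume (u t) u₀ := fun m hm => by
  obtain ⟨C, hC⟩ := exists_isTruncation_step hm
  exact ⟨hC.integrable_primitive_comp hm.le (Lp.memLp _),
    hC.integrable_primitive_comp hm.le (Lp.memLp _), hu.energy_le hp hT hC hm ht⟩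

theorem IsWeakSolution.stepDominated_neg (hp : 1 < p) (hT : 0 < T) (hu : IsWeakSolution p T u₀ u)
    {t : ℝ} (ht : t ∈ Icc 0 T) :
    StepDominated volume (fun x => -u t x) fun x => -u₀ x := fun m hm => by
  obtain ⟨C, hC⟩ := exists_isTruncation_step hm
  have h := hu.energy_le hp hT hC.reflect hm ht
  simp only [energy, primitive_reflect] at h
  exact ⟨hC.integrable_primitive_comp hm.le (Lp.memLp _).neg,
    hC.integrable_primitive_comp hm.le (Lp.memLp _).neg, h⟩

theorem IsWeakSolution.eLpNorm_top_le (hp : 1 < p) (hT : 0 < T) (hu : IsWeakSolution p T u₀ u)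
    (h₀ : MemLp u₀ ⊤ volume) {t : ℝ} (ht : t ∈ Icc 0 T) :
    eLpNorm (u t) ⊤ volume ≤ eLpNorm u₀ ⊤ volume := by
  set M := (eLpNorm u₀ ⊤ volume).toReal with hM
  have hMe : ENNReal.ofReal M = eLpNorm u₀ ⊤ volume := ENNReal.ofReal_toReal h₀.2.ne
  have hle : ∀ᵐ x, |u₀ x| ≤ M := by
    filter_upwards [ae_le_eLpNormEssSup (f := u₀) (μ := volume)] with x hx
    rw [← eLpNorm_exponent_top, ← hMe, Real.enorm_eq_ofReal_abs] at hx
    exact (ENNReal.ofReal_le_ofReal_iff ENNReal.toReal_nonneg).1 hx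
  have h1 := (hu.stepDominated hp hT ht).ae_le (M := M) ENNReal.toReal_nonneg
    (hle.mono fun x hx => (abs_le.1 hx).2)
  have h2 := (hu.stepDominated_neg hp hT ht).ae_le (M := M) ENNReal.toReal_nonneg
    (hle.mono fun x hx => by linarith [(abs_le.1 hx).1])
  rw [← hMe, eLpNorm_exponent_top]
  refine eLpNormEssSup_le_of_ae_bound ?_
  filter_upwards [h1, h2] with x hx1 hx2
  exact abs_le.2 ⟨by linarith, hx1⟩

theorem IsWeakSolution.ae_nonneg (hp : 1 < p) (hT : 0 < T) (hu : IsWeakSolution p T u₀ u)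
    (h₀ : ∀ᵐ x, 0 ≤ u₀ x) {t : ℝ} (ht : t ∈ Icc 0 T) : ∀ᵐ x, 0 ≤ u t x := by
  filter_upwards [(hu.stepDominated_neg hp hT ht).ae_le (M := 0) le_rfl
    (h₀.mono fun x hx => by simpa using hx)] with x hx
  simpa using hx

theorem enorm_eq_ofReal_add_ofReal_neg (r : ℝ) :
    ‖r‖ₑ = ENNReal.ofReal r + ENNReal.ofReal (-r) := by
  rw [Real.enorm_eq_ofReal_abs]
  rcases le_total 0 r with h | h
  · rw [abs_of_nonneg h, ENNReal.ofReal_of_nonpos (neg_nonpos.2 h), add_zero]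
  · rw [abs_of_nonpos h, ENNReal.ofReal_of_nonpos h, zero_add]

theorem IsWeakSolution.eLpNorm_one_le (hp : 1 < p) (hT : 0 < T) (hu : IsWeakSolution p T u₀ u)
    {t : ℝ} (ht : t ∈ Icc 0 T) : eLpNorm (u t) 1 volume ≤ eLpNorm u₀ 1 volume := by
  have hm : ∀ v : L2 d, eLpNorm v 1 volume =
      (∫⁻ x, ENNReal.ofReal (v x)) + ∫⁻ x, ENNReal.ofReal (-v x) := fun v => by
    rw [eLpNorm_one_eq_lintegral_enorm,
      ← lintegral_add_left' (Lp.aestronglyMeasurable v).aemeasurable.ennreal_ofReal]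
    simp only [enorm_eq_ofReal_add_ofReal_neg]
  rw [hm, hm]
  exact add_le_add (hu.stepDominated hp hT ht).lintegral_le
    (hu.stepDominated_neg hp hT ht).lintegral_le

theorem IsWeakSolution.memLp_one (hp : 1 < p) (hT : 0 < T) (hu : IsWeakSolution p T u₀ u)
    (h₀ : MemLp u₀ 1 volume) {t : ℝ} (ht : t ∈ Icc 0 T) : MemLp (u t) 1 volume :=
  ⟨Lp.aestronglyMeasurable _, (hu.eLpNorm_one_le hp hT ht).trans_lt h₀.2⟩

end Solution

end PLaplace

namespace PLaplace

open Filter Topology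

/-! ### Space-time representatives. -/

section SpaceTime

variable {d : ℕ} {T : ℝ}

theorem cylMeasure_eq_prod (d : ℕ) (T : ℝ) :
    cylMeasure d T = (volume.restrict (Ioo 0 T)).prod (volume : Measure (Space d)) := by
  rw [cylMeasure, Measure.volume_eq_prod, ← Measure.prod_restrict, Measure.restrict_univ]

/-- At a fixed point, mollification is the `L²` inner product with a translated kernel. -/
theorem continuous_mollify_apply (n : ℕ) (x : Space d) :
    Continuous fun v : L2 d => mollify n v x := by
  set ρ : Space d → ℝ := fun y => (stdBump (Space d) n).normed volume (x - y)
  have hρ : MemLp ρ 2 volume := by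
    have hc : Continuous ρ := (stdBump (Space d) n).continuous_normed.comp (by fun_prop)
    exact hc.memLp_of_hasCompactSupport
      ((stdBump (Space d) n).hasCompactSupport_normed.comp_homeomorph (Homeomorph.subLeft x))
  have h : (fun v : L2 d => mollify n v x) = fun v => inner ℝ (hρ.toLp ρ) v := by
    ext v
    rw [mollify_apply, L2.inner_def]
    refine integral_congr_ae ?_
    filter_upwards [hρ.coeFn_toLp] with y hy
    rw [hy]
    simp [ρ, mul_comm]
  rw [h]
  fun_prop

/-- A continuous curve in `L²` is represented by a function measurable in space and time. -/
theorem exists_stronglyMeasurable_version {u : ℝ → L2 d} (hT : 0 ≤ T)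
    (hu : ContinuousOn u (Icc 0 T)) :
    ∃ U : ℝ × Space d → ℝ, StronglyMeasurable U ∧
      ∀ t ∈ Icc 0 T, (fun x => U (t, x)) =ᵐ[volume] u t := by
  set w : ℝ → L2 d := fun t => u (projIcc 0 T hT t) with hw
  have hwc : Continuous w := hu.comp_continuous (by fun_prop) fun t => (projIcc 0 T hT t).2
  have hli : ∀ t, LocallyIntegrable (w t : Space d → ℝ) := fun t =>
    (Lp.memLp (w t)).locallyIntegrable (by norm_num)
  -- Continuity in `t` and measurability in `x` give joint measurability; the `limsup` over `n` is
  -- then measurable and recovers `u t` almost everywhere for every `t`.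
  set W : ℕ → ℝ × Space d → ℝ := fun n => Function.uncurry fun t x => mollify n (w t) x with hW
  have hWm : ∀ n, Measurable (W n) := fun n =>
    (stronglyMeasurable_uncurry_of_continuous_of_stronglyMeasurable
      (fun x => (continuous_mollify_apply n x).comp hwc)
      fun t => (contDiff_mollify (hli t) n).continuous.stronglyMeasurable).measurable
  refine ⟨fun z => limsup (fun n => W n z) atTop, (Measurable.limsup hWm).stronglyMeasurable,
    fun t ht => ?_⟩
  have hwt : w t = u t := by simp [hw, projIcc_of_mem hT ht]
  filter_upwards [ae_tendsto_mollify (hli t)] with x hx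
  rw [← hwt]
  exact hx.limsup_eq

theorem ae_cylMeasure_of_forall_ae {U : ℝ × Space d → ℝ} (hU : StronglyMeasurable U)
    {u : ℝ → L2 d} (hUu : ∀ t ∈ Icc 0 T, (fun x => U (t, x)) =ᵐ[volume] u t) {S : Set ℝ}
    (hS : MeasurableSet S) (h : ∀ t ∈ Icc 0 T, ∀ᵐ x, u t x ∈ S) :
    ∀ᵐ z ∂(cylMeasure d T), U z ∈ S := by
  rw [cylMeasure_eq_prod]
  refine (Measure.ae_prod_mem_iff_ae_ae_mem (hU.measurable hS)).2 ?_
  filter_upwards [ae_restrict_mem measurableSet_Ioo] with t ht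
  have ht' := Ioo_subset_Icc_self ht
  filter_upwards [h t ht', hUu t ht'] with x hx hx'
  rw [mem_preimage, hx']
  exact hx

end SpaceTime

/-! ### Bochner measurability in `L¹`. -/

section BochnerL1

variable {d : ℕ}

theorem memLp_one_indicator_closedBall (n : ℕ) (v : L2 d) :
    MemLp ((Metric.closedBall (0 : Space d) n).indicator v) 1 volume := by
  rw [memLp_indicator_iff_restrict Metric.isClosed_closedBall.measurableSet]
  have : IsFiniteMeasure ((volume : Measure (Space d)).restrict (Metric.closedBall 0 n)) :=
    ⟨by rw [Measure.restrict_apply_univ]; exact (isCompact_closedBall _ _).measure_lt_top⟩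
  exact ((Lp.memLp v).restrict _).mono_exponent (by norm_num)

/-- Restriction of an `L²` function to a ball, as an `L¹` function. -/
noncomputable def truncateL1 (n : ℕ) (v : L2 d) : Lp ℝ 1 (volume : Measure (Space d)) :=
  (memLp_one_indicator_closedBall n v).toLp _

theorem continuous_truncateL1 (n : ℕ) : Continuous (truncateL1 (d := d) n) := by
  set B := Metric.closedBall (0 : Space d) n with hB
  have hBm : MeasurableSet B := Metric.isClosed_closedBall.measurableSet
  have hC : (volume.restrict B univ) ^ (1 / (1 : ENNReal).toReal - 1 / (2 : ENNReal).toReal) ≠ ⊤ := by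
    rw [Measure.restrict_apply_univ]
    exact ENNReal.rpow_ne_top_of_nonneg (by norm_num) (isCompact_closedBall _ _).measure_lt_top.ne
  set C := (volume.restrict B univ) ^ (1 / (1 : ENNReal).toReal - 1 / (2 : ENNReal).toReal)
  have hL : LipschitzWith C.toNNReal (truncateL1 (d := d) n) := by
    intro v w
    rw [truncateL1, truncateL1, Lp.edist_toLp_toLp, ← indicator_sub',
      eLpNorm_indicator_eq_eLpNorm_restrict hBm, Lp.edist_def, ENNReal.coe_toNNReal hC, mul_comm]
    refine (eLpNorm_le_eLpNorm_mul_rpow_measure_univ (p := 1) (q := 2) (by norm_num)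
      ((Lp.aestronglyMeasurable v).sub (Lp.aestronglyMeasurable w)).restrict).trans ?_
    gcongr
    exact Measure.restrict_le_self
  exact hL.continuous

theorem tendsto_truncateL1 {v : L2 d} (hv : MemLp v 1 volume) :
    Tendsto (fun n => truncateL1 n v) atTop (𝓝 (hv.toLp v)) := by
  simp only [truncateL1]
  rw [Lp.tendsto_Lp_iff_tendsto_eLpNorm'']
  simp only [eLpNorm_one_eq_lintegral_enorm]
  have h0 : (∫⁻ _ : Space d, (0 : ENNReal)) = 0 := lintegral_zero
  rw [← h0]
  have hm := fun n : ℕ => (memLp_one_indicator_closedBall n v).1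
  refine tendsto_lintegral_of_dominated_convergence' (fun x => ‖v x‖ₑ)
    (fun n => ((hm n).sub hv.1).enorm) (fun n => Eventually.of_forall fun x => ?_) ?_
    (Eventually.of_forall fun x => ?_)
  · simp only [Pi.sub_apply]
    by_cases hx : x ∈ Metric.closedBall (0 : Space d) n
    · rw [indicator_of_mem hx, sub_self, enorm_zero]; exact zero_le
    · rw [indicator_of_notMem hx, zero_sub, enorm_neg]
  · have := hv.2.ne
    rwa [eLpNorm_one_eq_lintegral_enorm] at this
  · refine tendsto_const_nhds.congr' ?_
    filter_upwards [eventually_ge_atTop ⌈‖x‖⌉₊] with n hn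
    have hx : x ∈ Metric.closedBall (0 : Space d) n :=
      mem_closedBall_zero_iff.2 ((Nat.le_ceil ‖x‖).trans (Nat.cast_le.2 hn))
    simp only [Pi.sub_apply]
    rw [indicator_of_mem hx, sub_self, enorm_zero]

/-- A continuous curve in `L²` which is bounded in `L¹` belongs to `L^∞(0,T;L¹)`. -/
theorem memLinftyL1_of_continuousOn {T : ℝ} {u : ℝ → L2 d} (hc : ContinuousOn u (Icc 0 T))
    {B : ENNReal} (hB : B ≠ ⊤) (h : ∀ t ∈ Icc 0 T, eLpNorm (u t) 1 volume ≤ B) :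
    MemLinftyL1 T u := by
  have hm : ∀ t ∈ Icc 0 T, MemLp (u t) 1 volume := fun t ht =>
    ⟨Lp.aestronglyMeasurable _, (h t ht).trans_lt hB.lt_top⟩
  classical
  set v : ℝ → Lp ℝ 1 (volume : Measure (Space d)) := fun t =>
    if ht : MemLp (u t) 1 volume then ht.toLp (u t) else 0
  have hv : ∀ t (ht : t ∈ Icc 0 T), v t = (hm t ht).toLp (u t) := fun t ht => dif_pos (hm t ht)
  refine ⟨v, ⟨?_, ?_⟩, ?_⟩
  -- The curve is only known to be continuous in `L²`. Restricting to a ball is continuous from `L²`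
  -- to `L¹`, and the restrictions converge in `L¹` as the balls grow.
  · refine aestronglyMeasurable_of_tendsto_ae atTop (f := fun n t => truncateL1 n (u t))
      (fun n => ?_) ?_
    · exact ((continuous_truncateL1 n).comp_continuousOn
        (hc.mono Ioo_subset_Icc_self)).aestronglyMeasurable measurableSet_Ioo
    · filter_upwards [ae_restrict_mem measurableSet_Ioo] with t ht
      rw [hv t (Ioo_subset_Icc_self ht)]
      exact tendsto_truncateL1 _
  · rw [eLpNorm_exponent_top]
    refine (eLpNormEssSup_le_of_ae_bound (C := B.toReal) ?_).trans_lt ENNReal.ofReal_lt_top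
    filter_upwards [ae_restrict_mem measurableSet_Ioo] with t ht
    have ht' := Ioo_subset_Icc_self ht
    rw [hv t ht', Lp.norm_toLp]
    exact ENNReal.toReal_mono hB (h t ht')
  · filter_upwards [ae_restrict_mem measurableSet_Ioo] with t ht
    rw [hv t (Ioo_subset_Icc_self ht)]
    exact MemLp.coeFn_toLp _

end BochnerL1

end PLaplace

namespace PLaplace

open Filter Topology

/-! ### Conservation of mass when `p ≥ d`. -/

section Conservation

variable {d : ℕ} {p T : ℝ}

/-- Weak gradients are unique. -/
theorem HasWeakGradient.ae_eq {v : Space d → ℝ} {G₁ G₂ : Space d → Space d}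
    (h₁ : HasWeakGradient v G₁) (h₂ : HasWeakGradient v G₂) : G₁ =ᵐ[volume] G₂ := by
  refine ae_eq_of_integral_contDiff_smul_eq h₁.2.1 h₂.2.1 fun φ hφ hφs => ?_
  have hi : ∀ {G : Space d → Space d}, LocallyIntegrable G → Integrable fun x => φ x • G x :=
    fun hG => hG.integrable_smul_left_of_hasCompactSupport hφ.continuous hφs
  refine ext_inner_left ℝ fun y => ?_
  rw [← integral_inner (hi h₁.2.1), ← integral_inner (hi h₂.2.1)]
  have h := (h₁.2.2 φ ⟨hφ, hφs⟩ y).symm.trans (h₂.2.2 φ ⟨hφ, hφs⟩ y)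
  rw [neg_inj] at h
  simpa only [inner_smul_right, real_inner_comm y] using h

theorem memLp_fderiv_cutoff_snd (n : ℕ) (q : ENNReal) :
    MemLp (fun z : ℝ × Space d => fderiv ℝ (cutoff d n) z.2) q (cylMeasure d T) := by
  rw [cylMeasure_eq_prod]
  have hc := (isTestFunction_cutoff (d := d) n)
  have h : MemLp (fderiv ℝ (cutoff d n)) q volume :=
    (hc.1.continuous_fderiv (by simp)).memLp_of_hasCompactSupport (hc.2.fderiv ℝ)
  exact h.comp_snd _

/-- The flux through the annulus where the cutoff is not constant. -/
noncomputable def cutoffFlux (p T : ℝ) (n : ℕ) (G : ℝ × Space d → Space d) : ℝ :=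
  ∫ z, ‖fderiv ℝ (cutoff d n) z.2‖ * ‖‖G z‖ ^ (p - 2) • G z‖ ∂(cylMeasure d T)

/-- The place where `p ≥ d` is needed: `|∇χ|^p ≤ (K/(n+1))^p` on a ball of volume proportional to
`(n+1)^d`. -/
theorem exists_integral_fderiv_cutoff_rpow_le (hp : 1 < p) (hdp : (d : ℝ) ≤ p) :
    ∃ K : ℝ, ∀ n, ∫ z, ‖fderiv ℝ (cutoff d n) z.2‖ ^ p ∂(cylMeasure d T) ≤ K := by
  obtain ⟨K, hK0, hK⟩ := exists_norm_fderiv_cutoff_le d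
  set τ := (volume.restrict (Ioo 0 T)).real univ
  set c := (volume : Measure (Space d)).real (Metric.closedBall 0 1)
  refine ⟨τ * (K ^ p * 2 ^ d * c), fun n => ?_⟩
  have hn : (0 : ℝ) < n + 1 := by positivity
  have h1 : ∫ z, ‖fderiv ℝ (cutoff d n) z.2‖ ^ p ∂(cylMeasure d T) =
      τ * ∫ x, ‖fderiv ℝ (cutoff d n) x‖ ^ p := by
    rw [cylMeasure_eq_prod]
    have := integral_prod_mul (μ := volume.restrict (Ioo 0 T)) (ν := (volume : Measure (Space d)))
      (fun _ => (1 : ℝ)) fun x => ‖fderiv ℝ (cutoff d n) x‖ ^ p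
    simpa [τ] using this
  rw [h1]
  have hvol : (volume : Measure (Space d)).real (Metric.closedBall 0 (2 * ((n : ℝ) + 1))) =
      2 ^ d * ((n : ℝ) + 1) ^ d * c := by
    rw [Measure.real, Measure.addHaar_closedBall' _ _ (by positivity), ENNReal.toReal_mul,
      ENNReal.toReal_ofReal (by positivity), finrank_euclideanSpace_fin, mul_pow]
    rfl
  have h2 : ∫ x, ‖fderiv ℝ (cutoff d n) x‖ ^ p ≤
      (K / (n + 1)) ^ p * (2 ^ d * ((n : ℝ) + 1) ^ d * c) := by
    rw [← hvol]
    have hsupp : ∀ x ∉ Metric.closedBall (0 : Space d) (2 * ((n : ℝ) + 1)),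
        ‖fderiv ℝ (cutoff d n) x‖ ^ p = 0 := fun x hx => by
      rw [mem_closedBall_zero_iff, not_le] at hx
      rw [fderiv_cutoff_eq_zero_of_gt hx, norm_zero, Real.zero_rpow (by linarith)]
    rw [← setIntegral_eq_integral_of_forall_compl_eq_zero hsupp]
    refine (Real.le_norm_self _).trans (norm_setIntegral_le_of_norm_le_const
      (isCompact_closedBall _ _).measure_lt_top fun x _ => ?_)
    rw [Real.norm_of_nonneg (by positivity)]
    exact Real.rpow_le_rpow (norm_nonneg _) (hK n x) (by linarith)
  gcongr
  refine h2.trans ?_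
  rw [Real.div_rpow hK0 hn.le]
  have h3 : ((n : ℝ) + 1) ^ d ≤ ((n : ℝ) + 1) ^ p := by
    rw [← Real.rpow_natCast]
    exact Real.rpow_le_rpow_of_exponent_le (by simp) hdp
  have hpp : 0 < ((n : ℝ) + 1) ^ p := by positivity
  calc K ^ p / ((n : ℝ) + 1) ^ p * (2 ^ d * ((n : ℝ) + 1) ^ d * c)
      = K ^ p * 2 ^ d * c * (((n : ℝ) + 1) ^ d / ((n : ℝ) + 1) ^ p) := by ring
    _ ≤ K ^ p * 2 ^ d * c * 1 := by
        gcongr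
        exact (div_le_one hpp).2 h3
    _ = _ := mul_one _

/-- For `p = d` the bound on the cutoff gradients gives no decay. It comes from the flux: the
gradients vanish for `|x| < n + 1`, so Hölder involves only the tail of a fixed `L^{p/(p-1)}`
function. -/
theorem tendsto_cutoffFlux (hp : 1 < p) (hdp : (d : ℝ) ≤ p) {G : ℝ × Space d → Space d}
    (hG : MemLp G (ENNReal.ofReal p) (cylMeasure d T)) :
    Tendsto (fun n => cutoffFlux p T n G) atTop (𝓝 0) := by
  obtain ⟨K, hK⟩ := exists_integral_fderiv_cutoff_rpow_le (d := d) (T := T) hp hdp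
  have hK0 : 0 ≤ K := (integral_nonneg fun z => by positivity).trans (hK 0)
  set F : ℝ × Space d → Space d := fun z => ‖G z‖ ^ (p - 2) • G z with hF
  set q := p / (p - 1) with hq
  have hpq : p.HolderConjugate q := Real.HolderConjugate.conjExponent hp
  have hF' : MemLp F (ENNReal.ofReal q) (cylMeasure d T) := memLp_flux hp hG
  have hq0 : 0 < q := hpq.symm.pos
  set S : ℕ → Set (ℝ × Space d) := fun n => {z | (n : ℝ) + 1 ≤ ‖z.2‖} with hS
  have hSm : ∀ n, MeasurableSet (S n) := fun n =>
    measurableSet_le measurable_const measurable_snd.norm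
  have hle : ∀ n, cutoffFlux p T n G ≤
      K ^ (1 / p) * (∫ z, ‖(S n).indicator F z‖ ^ q ∂(cylMeasure d T)) ^ (1 / q) := by
    intro n
    have e : cutoffFlux p T n G =
        ∫ z, ‖fderiv ℝ (cutoff d n) z.2‖ * ‖(S n).indicator F z‖ ∂(cylMeasure d T) := by
      refine integral_congr_ae (Eventually.of_forall fun z => ?_)
      by_cases hz : z ∈ S n
      · simp only [indicator_of_mem hz, hF]
      · have : fderiv ℝ (cutoff d n) z.2 = 0 := fderiv_cutoff_eq_zero_of_lt (not_le.1 hz)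
        simp only [this, norm_zero, zero_mul]
    rw [e]
    have h := integral_mul_norm_le_Lp_mul_Lq hpq
      (memLp_fderiv_cutoff_snd (d := d) (T := T) n (ENNReal.ofReal p)).norm
      (hF'.indicator (hSm n)).norm
    simp only [norm_norm] at h
    refine h.trans ?_
    gcongr
    exact hK n
  have hlim : Tendsto (fun n => ∫ z, ‖(S n).indicator F z‖ ^ q ∂(cylMeasure d T)) atTop
      (𝓝 0) := by
    have h0 : (0 : ℝ) = ∫ _ : ℝ × Space d, (0 : ℝ) ∂(cylMeasure d T) := by simp
    rw [h0]
    have hint : Integrable (fun z => ‖F z‖ ^ q) (cylMeasure d T) := by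
      have := hF'.integrable_norm_rpow (by simpa using hq0) ENNReal.ofReal_ne_top
      rwa [ENNReal.toReal_ofReal hq0.le] at this
    refine tendsto_integral_of_dominated_convergence (fun z => ‖F z‖ ^ q)
      (fun n => ((hF'.indicator (hSm n)).1.norm.aemeasurable.pow_const q).aestronglyMeasurable)
      hint (fun n => Eventually.of_forall fun z => ?_) (Eventually.of_forall fun z => ?_)
    · rw [Real.norm_of_nonneg (by positivity)]
      gcongr
      exact norm_indicator_le_norm_self _ _
    · refine tendsto_const_nhds.congr' ?_
      filter_upwards [eventually_ge_atTop ⌈‖z.2‖⌉₊] with n hn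
      have hz : z ∉ S n := by
        have := (Nat.le_ceil ‖z.2‖).trans (Nat.cast_le.2 hn)
        simp only [hS, mem_ofPred_eq, not_le]
        linarith
      rw [indicator_of_notMem hz, norm_zero, Real.zero_rpow hq0.ne']
  have hlim2 := (hlim.rpow_const (p := 1 / q) (Or.inr (by positivity))).const_mul (K ^ (1 / p))
  rw [Real.zero_rpow (by positivity), mul_zero] at hlim2
  exact squeeze_zero (fun n => integral_nonneg fun z => by positivity) hle hlim2

variable {u₀ : L2 d} {u : ℝ → L2 d}

/-- The cutoff functions as elements of `L²`. -/
noncomputable def cutoffL2 (d n : ℕ) : L2 d :=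
  ((isTestFunction_cutoff (d := d) n).1.continuous.memLp_of_hasCompactSupport
    (isTestFunction_cutoff n).2 : MemLp (cutoff d n) 2 volume).toLp _

theorem inner_cutoffL2 (n : ℕ) (v : L2 d) :
    inner ℝ (cutoffL2 d n) v = ∫ x, cutoff d n x * v x := by
  rw [L2.inner_def]
  refine integral_congr_ae ?_
  filter_upwards [MemLp.coeFn_toLp ((isTestFunction_cutoff (d := d) n).1.continuous.memLp_of_hasCompactSupport
    (isTestFunction_cutoff n).2 : MemLp (cutoff d n) 2 volume)] with x hx
  rw [cutoffL2, hx]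
  simp [mul_comm]

theorem IsNegPLaplacian.abs_inner_cutoffL2_le (hp : 1 < p) {v f : L2 d}
    (h : IsNegPLaplacian p v f) {G : Space d → Space d} (hG : HasWeakGradient v G) (n : ℕ) :
    |inner ℝ (cutoffL2 d n) f| ≤
      ∫ x, ‖fderiv ℝ (cutoff d n) x‖ * ‖‖G x‖ ^ (p - 2) • G x‖ := by
  obtain ⟨G', hG'm, hG', hdiv⟩ := h
  -- The gradient supplied by the operator and the slice of the space-time gradient are chosen
  -- separately; uniqueness identifies them.
  have hGG := hG'.ae_eq hG
  have hχ := isTestFunction_cutoff (d := d) n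
  have h1 := hdiv.2.2 _ hχ
  simp only [mul_neg, integral_neg, neg_neg] at h1
  rw [inner_cutoffL2, ← h1, ← Real.norm_eq_abs]
  refine norm_integral_le_of_norm_le ?_ ?_
  · have hF := memLp_flux hp ((memLp_congr_ae hGG).1 hG'm)
    refine integrable_norm_mul_norm hp ?_ hF
    exact (hχ.1.continuous_fderiv (by simp)).memLp_of_hasCompactSupport (hχ.2.fderiv ℝ)
  · filter_upwards [hGG] with x hx
    rw [hx]
    exact ContinuousLinearMap.le_opNorm _ _

theorem IsWeakSolution.abs_inner_cutoffL2_sub_le (hp : 1 < p) (hT : 0 < T)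
    (hu : IsWeakSolution p T u₀ u) {G : ℝ × Space d → Space d}
    (hG : MemLp G (ENNReal.ofReal p) (cylMeasure d T))
    (hGu : ∀ᵐ t ∂(volume.restrict (Ioo 0 T)), HasWeakGradient (u t) (fun x => G (t, x)))
    (n : ℕ) {t : ℝ} (ht : t ∈ Icc 0 T) :
    |inner ℝ (cutoffL2 d n) (u t) - inner ℝ (cutoffL2 d n) u₀| ≤ cutoffFlux p T n G := by
  obtain ⟨a, -, ha⟩ := hu.equation
  set h : ℝ → ℝ := fun t =>
    ∫ x, ‖fderiv ℝ (cutoff d n) x‖ * ‖‖G (t, x)‖ ^ (p - 2) • G (t, x)‖ with hh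
  have hint : Integrable (fun z : ℝ × Space d =>
      ‖fderiv ℝ (cutoff d n) z.2‖ * ‖‖G z‖ ^ (p - 2) • G z‖)
      ((volume.restrict (Ioo 0 T)).prod volume) := by
    rw [← cylMeasure_eq_prod]
    exact integrable_norm_mul_norm hp (memLp_fderiv_cutoff_snd n _) (memLp_flux hp hG)
  have hhi : IntegrableOn h (Ioo 0 T) := hint.integral_prod_left
  have hhe : cutoffFlux p T n G = ∫ t in Ioo 0 T, h t := by
    rw [cutoffFlux, cylMeasure_eq_prod, integral_prod _ hint]
  -- Both signs of the cutoff turn the one-sided growth bound into a bound on the absolute value.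
  have key : ∀ c : L2 d, (c = cutoffL2 d n ∨ c = -cutoffL2 d n) →
      inner ℝ c (u t) - inner ℝ c u₀ ≤ cutoffFlux p T n G := by
    intro c hc
    rw [hhe, ← hu.initial]
    refine sub_le_setIntegral_of_ae_hasDerivAt_le hT (f := fun t => inner ℝ c (u t))
      ((innerSL ℝ c).continuous.comp_continuousOn hu.continuousOn)
      (fun s t hs hst ht => absolutelyContinuousOnInterval_of_lipschitz_comp (C := ‖c‖)
        (hu.absolutelyContinuousOnInterval hs hst ht) fun x _ y _ => ?_) hhi
      (Eventually.of_forall fun t => integral_nonneg fun x => by positivity) ?_ ht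
    · rw [Real.dist_eq, ← inner_sub_right, dist_eq_norm]
      exact abs_real_inner_le_norm _ _
    · filter_upwards [ha, hGu] with t ht hGt
      refine ⟨inner ℝ c (-a t), ?_, (innerSL ℝ c).hasFDerivAt.comp_hasDerivAt t ht.2⟩
      have hb := abs_le.1 (ht.1.abs_inner_cutoffL2_le hp hGt n)
      rcases hc with rfl | rfl
      · rw [inner_neg_right]
        linarith [hb.1]
      · rw [inner_neg_neg]
        exact hb.2
  have h1 := key _ (Or.inl rfl)
  have h2 := key _ (Or.inr rfl)
  rw [inner_neg_left, inner_neg_left] at h2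
  exact abs_le.2 ⟨by linarith, h1⟩

/-- Conservation of mass. -/
theorem IsWeakSolution.integral_eq (hp : 1 < p) (hT : 0 < T) (hdp : (d : ℝ) ≤ p)
    (hu : IsWeakSolution p T u₀ u) {t : ℝ} (ht : t ∈ Icc 0 T) (h₀ : Integrable u₀)
    (ht₁ : Integrable (u t)) : ∫ x, u t x = ∫ x, u₀ x := by
  obtain ⟨G, hG, hGu⟩ := hu.gradient
  have h1 : Tendsto (fun n => |inner ℝ (cutoffL2 d n) (u t) - inner ℝ (cutoffL2 d n) u₀|) atTop
      (𝓝 0) :=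
    squeeze_zero (fun _ => abs_nonneg _)
      (fun n => hu.abs_inner_cutoffL2_sub_le hp hT hG hGu n ht) (tendsto_cutoffFlux hp hdp hG)
  have h2 : Tendsto (fun n => |inner ℝ (cutoffL2 d n) (u t) - inner ℝ (cutoffL2 d n) u₀|) atTop
      (𝓝 |(∫ x, u t x) - ∫ x, u₀ x|) := by
    simp only [inner_cutoffL2]
    exact ((tendsto_integral_cutoff_mul ht₁).sub (tendsto_integral_cutoff_mul h₀)).abs
  exact sub_eq_zero.1 (abs_eq_zero.1 (tendsto_nhds_unique h2 h1))

end Conservation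

end PLaplace

theorem theorem2p4 (d : ℕ) (hd : 1 ≤ d) (p : ℝ) (hp : 1 < p) (T : ℝ) (hT : 0 < T)
    (u₀ : PLaplace.L2 d) (u : ℝ → PLaplace.L2 d)
    (hu : PLaplace.IsWeakSolution p T u₀ u) :
    ∃ U : ℝ × PLaplace.Space d → ℝ, PLaplace.IsSpaceTimeVersion T u U ∧
      (MemLp u₀ ⊤ volume →
        MemLp U ⊤ (PLaplace.cylMeasure d T) ∧
          ∀ᵐ t ∂(volume.restrict (Ioo 0 T)), eLpNorm (u t) ⊤ volume ≤ eLpNorm u₀ ⊤ volume) ∧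
      (MemLp u₀ 1 volume →
        PLaplace.MemLinftyL1 T u ∧
          ((∀ᵐ x ∂volume, 0 ≤ u₀ x) → ∀ᵐ z ∂(PLaplace.cylMeasure d T), 0 ≤ U z) ∧
          ((d : ℝ) ≤ p → ∀ t ∈ Icc 0 T,
            Integrable (u t) volume ∧ ∫ x, u t x = ∫ x, u₀ x)) := by
  obtain ⟨U, hU, hUu⟩ := PLaplace.exists_stronglyMeasurable_version hT.le hu.continuousOn
  refine ⟨U, ⟨hU.aestronglyMeasurable, ?_⟩, fun h₀ => ⟨⟨hU.aestronglyMeasurable, ?_⟩, ?_⟩,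
    fun h₀ => ⟨?_, fun hpos => ?_, fun hdp t ht => ?_⟩⟩
  · filter_upwards [ae_restrict_mem measurableSet_Ioo] with t ht
    exact hUu t (Ioo_subset_Icc_self ht)
  · have hM : ∀ t ∈ Icc 0 T, ∀ᵐ x, u t x ∈
        Metric.closedBall (0 : ℝ) (eLpNorm u₀ ⊤ volume).toReal := by
      intro t ht
      have hle := hu.eLpNorm_top_le hp hT h₀ ht
      filter_upwards [ae_le_eLpNormEssSup (f := u t) (μ := volume)] with x hx
      rw [← eLpNorm_exponent_top] at hx
      rw [mem_closedBall_zero_iff, ← toReal_enorm]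
      exact ENNReal.toReal_mono h₀.2.ne (hx.trans hle)
    have hae := PLaplace.ae_cylMeasure_of_forall_ae hU hUu
      Metric.isClosed_closedBall.measurableSet hM
    rw [eLpNorm_exponent_top]
    exact (eLpNormEssSup_le_of_ae_bound
      (hae.mono fun z hz => mem_closedBall_zero_iff.1 hz)).trans_lt ENNReal.ofReal_lt_top
  · filter_upwards [ae_restrict_mem measurableSet_Ioo] with t ht
    exact hu.eLpNorm_top_le hp hT h₀ (Ioo_subset_Icc_self ht)
  · exact PLaplace.memLinftyL1_of_continuousOn hu.continuousOn h₀.2.ne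
      fun t ht => hu.eLpNorm_one_le hp hT ht
  · exact PLaplace.ae_cylMeasure_of_forall_ae hU hUu measurableSet_Ici
      fun t ht => hu.ae_nonneg hp hT hpos ht
  · have hint := memLp_one_iff_integrable.1 (hu.memLp_one hp hT h₀ ht)
    exact ⟨hint, hu.integral_eq hp hT hdp ht (memLp_one_iff_integrable.1 h₀) hint⟩
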